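/- Let $d\in\{2,3\}$, let $\Omega\subset\mathbb R^d$ be a convex polytopal domain (the nonempty interior of the convex hull of finitely many points), $\mathcal C=\Omega\times(0,\infty)$, $s\in(0,1)$, $\alpha=1-2s$ and $d_s=2^{1-2s}\Gamma(1-s)/\Gamma(s)$. Let $A\in L^\infty(\Omega;\mathbb R^{d\times d})$ be symmetric and uniformly positive definite, $\mathbf A=\operatorname{diag}\{A,1\}$, $\bar q>0$, $\rho>0$, $z_\delta\in L^2(\Omega)$, $q^*\in L^2(\Omega)$, and $\mathcal Q=\{q\in L^\infty(\Omega): 0\le q\le\bar q \text{ a.e. in }\Omega\}$. Let $\mathbb H^s(\Omega)$ be the space of all $w\in L^2(\Omega)$ with $\|w\|_{\mathbb H^s(\Omega)}^2=\sum_k\lambda_k^s(w,\varphi_k)_{L^2(\Omega)}^2<\infty$, where $(\varphi_k)$ is an $L^2(\Omega)$-orthonormal basis of eigenfunctions of the Dirichlet Laplacian on $\Omega$ with eigenvalues $\lambda_k$, and let $f\in\mathbb H^{-s}(\Omega)$, the dual of $\mathbb H^s(\Omega)$. Let $\mathring H^1_L(y^\alpha,\mathcal C)$ be the space of all $w\in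 L^2(y^\alpha,\mathcal C)$ with distributional gradient in $L^2(y^\alpha,\mathcal C)$ which vanish on $\partial\Omega\times(0,\infty)$, and $\operatorname{tr}w$ the trace of $w$ on $\Omega\times\{0\}$. For $q\in\mathcal Q$ put $$a(w,\phi)(q)=\int_{\mathcal C}y^\alpha\left(\mathbf A\nabla w\cdot\nabla\phi+q\,w\,\phi\right)dx'\,dy .$$ For every $q\in\mathcal Q$ there are a unique state $E(q)\in\mathring H^1_L(y^\alpha,\mathcal C)$ with $a(E(q),\phi)(q)=d_s\langle f,\operatorname{tr}\phi\rangle$ for all $\phi\in\mathring H^1_L(y^\alpha,\mathcal C)$, and a unique adjoint state $\mathscr P(q)\in\mathring H^1_L(y^\alpha,\mathcal C)$ with $a(w,\mathscr P(q))(q)=d_s(\operatorname{tr}E(q)-z_\delta,\operatorname{tr}w)_{L^2(\Omega)}$ for all $w\in\mathring H^1_L(y^\alpha,\mathcal C)$. Define $$\mathcal J_{\delta,\rho}(q)=\tfrac12\|\operatorname{tr}E(q)-z_\delta\|_{L^2(\Omega)}^2+\tfrac\rho2\|q-q^*\|_{L^2(\Omega)}^2,\qquad \mathfrak p(q)=-\frac1{d_s}\int_0^\infty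 y^\alpha E(q)\,\mathscr P(q)\,dy .$$ **Theorem.** Let $q_{\delta,\rho}\in\mathcal Q$ minimize $\mathcal J_{\delta,\rho}$ over $\mathcal Q$, and assume that the function $x'\mapsto\int_0^\infty y^\alpha E(q_{\delta,\rho})(x',y)^2\,dy$ belongs to $L^\infty(\Omega)$. Then $\mathfrak p(q_{\delta,\rho})\in L^2(\Omega)$ and $$\left(\mathfrak p(q_{\delta,\rho})+\rho(q_{\delta,\rho}-q^*),\,q-q_{\delta,\rho}\right)_{L^2(\Omega)}\ge 0\qquad\text{for all }q\in\mathcal Q .$$ -/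

import Mathlib

open MeasureTheory Set
open scoped ENNReal ContDiff RealInnerProductSpace

noncomputable section

namespace FracIdent

/-- The Euclidean space `ℝ^d`. -/
abbrev E (d : ℕ) : Type := EuclideanSpace ℝ (Fin d)

/-- A convex polytopal domain: the nonempty interior of the convex hull of finitely many points. -/
def IsConvexPolytopalDomain {d : ℕ} (Ω : Set (E d)) : Prop :=
  Ω.Nonempty ∧ ∃ S : Finset (E d), Ω = interior (convexHull ℝ (S : Set (E d)))

/-- The diffusion matrix: `A ∈ L^∞(Ω)`, symmetric, uniformly positive definite. -/
structure IsDiffusionMatrix {d : ℕ} (Ω : Set (E d))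
    (A : E d → Matrix (Fin d) (Fin d) ℝ) : Prop where
  bounded : ∀ i j, MemLp (fun x => A x i j) ∞ (volume.restrict Ω)
  symm : ∀ᵐ x ∂(volume.restrict Ω), (A x).IsSymm
  elliptic : ∃ c > 0, ∀ᵐ x ∂(volume.restrict Ω), ∀ ξ : E d,
    c * ‖ξ‖ ^ 2 ≤ ⟪(A x).toEuclideanLin ξ, ξ⟫

/-- The set `𝒬 = {q ∈ L^∞(Ω) : 0 ≤ q ≤ qbar a.e. in Ω}` of admissible coefficients. -/
def admissible {d : ℕ} (Ω : Set (E d)) (qbar : ℝ) : Set (E d → ℝ) :=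
  {q | AEStronglyMeasurable q (volume.restrict Ω) ∧
    ∀ᵐ x ∂(volume.restrict Ω), 0 ≤ q x ∧ q x ≤ qbar}

/-! ### The spaces `L²(Ω)`, `H¹₀(Ω)`, `ℍ^s(Ω)` -/

/-- The Hilbert space `L²(Ω)`. -/
abbrev L2 {d : ℕ} (Ω : Set (E d)) : Type := Lp ℝ 2 (volume.restrict Ω)

/-- Pairs `(v, G)` in `L²(Ω) × L²(Ω; ℝ^d)`; the norm is `(‖v‖² + ‖G‖²)^{1/2}`. -/
abbrev L2Pair {d : ℕ} (Ω : Set (E d)) : Type :=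
  WithLp 2 (L2 Ω × Lp (E d) 2 (volume.restrict Ω))

/-- `φ ∈ C_c^∞(Ω)`. -/
def IsTest {d : ℕ} (Ω : Set (E d)) (φ : E d → ℝ) : Prop :=
  ContDiff ℝ ∞ φ ∧ HasCompactSupport φ ∧ tsupport φ ⊆ Ω

/-- `H¹(Ω)`, each element `v` being listed together with its distributional gradient `G`. -/
def H1 {d : ℕ} (Ω : Set (E d)) : Set (L2Pair Ω) :=
  {p | ∀ ψ : E d → ℝ, IsTest Ω ψ →
    ∫ x in Ω, p.fst x • gradient ψ x = - ∫ x in Ω, ψ x • p.snd x}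

/-- `H¹₀(Ω)`: the closure of `C_c^∞(Ω)` in `H¹(Ω)`. -/
def H10 {d : ℕ} (Ω : Set (E d)) : Set (L2Pair Ω) :=
  H1 Ω ∩ closure {p | ∃ φ : E d → ℝ, IsTest Ω φ ∧
    p.fst =ᵐ[volume.restrict Ω] φ ∧ p.snd =ᵐ[volume.restrict Ω] gradient φ}

/-- `(lam, v)` is an eigenpair of the Dirichlet Laplacian on `Ω`. -/
def IsDirichletEigenpair {d : ℕ} (Ω : Set (E d)) (lam : ℝ) (v : L2 Ω) : Prop :=
  v ≠ 0 ∧ ∃ p ∈ H10 Ω, p.fst = v ∧ ∀ r ∈ H10 Ω, ⟪p.snd, r.snd⟫ = lam * ⟪p.fst, r.fst⟫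

/-- The squared norm `∑ₖ λₖ^s wₖ²` of `ℍ^s(Ω)`, `wₖ = (w, φₖ)` being the coefficients of `w` with
respect to `L²`-orthonormal eigenfunctions of the Dirichlet Laplacian: the supremum of the finite
sums over orthonormal systems of eigenfunctions. It agrees with the sum over any orthonormal basis
of eigenfunctions, see `hsNormSq_eq_tsum`. -/
def hsNormSq {d : ℕ} (Ω : Set (E d)) (s : ℝ) (w : L2 Ω) : ℝ≥0∞ :=
  ⨆ (n : ℕ) (lam : Fin n → ℝ) (v : Fin n → L2 Ω) (_ : Orthonormal ℝ v)
    (_ : ∀ i, IsDirichletEigenpair Ω (lam i) (v i)),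
    ∑ i, ENNReal.ofReal (lam i ^ s * ⟪v i, w⟫ ^ 2)

theorem IsDirichletEigenpair.nonneg {d : ℕ} {Ω : Set (E d)} {lam : ℝ} {v : L2 Ω}
    (h : IsDirichletEigenpair Ω lam v) : 0 ≤ lam := by
  obtain ⟨hv, p, hp, rfl, h⟩ := h
  have h1 := h p hp
  rw [real_inner_self_eq_norm_sq, real_inner_self_eq_norm_sq] at h1
  have : 0 < ‖p.fst‖ ^ 2 := by have := norm_pos_iff.2 hv; positivity
  by_contra hl
  nlinarith [sq_nonneg ‖p.snd‖]

theorem IsDirichletEigenpair.inner_eq_zero {d : ℕ} {Ω : Set (E d)} {lam mu : ℝ} {v w : L2 Ω}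
    (h : IsDirichletEigenpair Ω lam v) (h' : IsDirichletEigenpair Ω mu w) (hne : lam ≠ mu) :
    ⟪v, w⟫ = 0 := by
  obtain ⟨-, p, hp, rfl, h⟩ := h
  obtain ⟨-, r, hr, rfl, h'⟩ := h'
  have h1 := h r hr
  have h2 := h' p hp
  rw [real_inner_comm, real_inner_comm p.fst] at h2
  have h3 : (lam - mu) * ⟪p.fst, r.fst⟫ = 0 := by
    linear_combination h2 - h1
  rcases mul_eq_zero.1 h3 with h4 | h4
  · exact absurd (sub_eq_zero.1 h4) hne
  · exact h4

/-- For every orthonormal basis `φₖ` of `L²(Ω)` of eigenfunctions, with eigenvalues `λₖ`,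
`‖w‖²_{ℍ^s(Ω)} = ∑ₖ λₖ^s (φₖ, w)²`. -/
theorem hsNormSq_eq_tsum {d : ℕ} {Ω : Set (E d)} (s : ℝ) (b : HilbertBasis ℕ ℝ (L2 Ω))
    (lam : ℕ → ℝ) (hb : ∀ k, IsDirichletEigenpair Ω (lam k) (b k)) (w : L2 Ω) :
    hsNormSq Ω s w = ∑' k, ENNReal.ofReal (lam k ^ s * ⟪b k, w⟫ ^ 2) := by
  apply le_antisymm
  · by_cases hfin : ∑' k, ENNReal.ofReal (lam k ^ s * ⟪b k, w⟫ ^ 2) = ⊤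
    · rw [hfin]; exact le_top
    have hpos : ∀ k, 0 ≤ lam k ^ s * ⟪b k, w⟫ ^ 2 := fun k =>
      mul_nonneg (Real.rpow_nonneg (hb k).nonneg _) (sq_nonneg _)
    have hsum : Summable fun k => lam k ^ s * ⟪b k, w⟫ ^ 2 := by
      have := ENNReal.summable_toReal hfin
      simpa only [ENNReal.toReal_ofReal (hpos _)] using this
    have hsq : ∀ k, (lam k ^ (s / 2) * ⟪b k, w⟫) ^ 2 = lam k ^ s * ⟪b k, w⟫ ^ 2 := fun k => by
      rw [mul_pow, ← Real.rpow_natCast, ← Real.rpow_mul (hb k).nonneg]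
      norm_num
    have hmem : Memℓp (fun k => lam k ^ (s / 2) * ⟪b k, w⟫) 2 := by
      apply memℓp_gen
      refine hsum.congr fun k => ?_
      rw [← hsq k]
      simp [mul_pow, sq_abs]
    set c : lp (fun _ : ℕ => ℝ) 2 := ⟨_, hmem⟩ with hc
    set u : L2 Ω := b.repr.symm c with hu
    have hu2 : ‖u‖ ^ 2 = ∑' k, lam k ^ s * ⟪b k, w⟫ ^ 2 := by
      rw [hu, LinearIsometryEquiv.norm_map]
      have h := lp.norm_rpow_eq_tsum (p := 2) (by norm_num) c
      norm_num at h
      rw [h]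
      exact tsum_congr fun k => by rw [← hsq k]
    have hbu : ∀ k, ⟪b k, u⟫ = lam k ^ (s / 2) * ⟪b k, w⟫ := fun k => by
      rw [← b.repr_apply_apply, hu, LinearIsometryEquiv.apply_symm_apply]
    rw [← ENNReal.ofReal_tsum_of_nonneg hpos hsum, ← hu2]
    refine iSup_le fun n => iSup_le fun mu => iSup_le fun v => iSup_le fun hv =>
      iSup_le fun hev => ?_
    have hvu : ∀ i, mu i ^ s * ⟪v i, w⟫ ^ 2 = ⟪v i, u⟫ ^ 2 := fun i => by
      have h1 : ⟪v i, u⟫ = mu i ^ (s / 2) * ⟪v i, w⟫ := by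
        rw [← b.tsum_inner_mul_inner (v i) u, ← b.tsum_inner_mul_inner (v i) w, ← tsum_mul_left]
        refine tsum_congr fun k => ?_
        rw [hbu k]
        by_cases hk : mu i = lam k
        · rw [hk]; ring
        · rw [(hev i).inner_eq_zero (hb k) hk]; ring
      rw [h1, mul_pow, ← Real.rpow_natCast (mu i ^ (s / 2)), ← Real.rpow_mul (hev i).nonneg]
      norm_num
    simp only [hvu]
    rw [← ENNReal.ofReal_sum_of_nonneg fun i _ => sq_nonneg _]
    apply ENNReal.ofReal_le_ofReal
    have := hv.sum_inner_products_le u (s := Finset.univ)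
    simpa using this
  · rw [ENNReal.tsum_eq_iSup_sum]
    refine iSup_le fun T => ?_
    let e := T.equivFin.symm
    have horth : Orthonormal ℝ fun i => b (e i : ℕ) :=
      b.orthonormal.comp _ (Subtype.val_injective.comp e.injective)
    have hle : ∑ i, ENNReal.ofReal (lam (e i) ^ s * ⟪b (e i : ℕ), w⟫ ^ 2) ≤ hsNormSq Ω s w :=
      le_iSup_of_le T.card <| le_iSup_of_le (fun i => lam (e i)) <|
        le_iSup_of_le (fun i => b (e i : ℕ)) <| le_iSup_of_le horth <|
        le_iSup_of_le (fun i => hb (e i)) le_rfl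
    refine le_trans (le_of_eq ?_) hle
    rw [e.sum_comp (fun k : T => ENNReal.ofReal (lam k ^ s * ⟪b (k : ℕ), w⟫ ^ 2)),
      Finset.sum_coe_sort T (fun k => ENNReal.ofReal (lam k ^ s * ⟪b k, w⟫ ^ 2))]

theorem hsNormSq_add_le {d : ℕ} (Ω : Set (E d)) (s : ℝ) (u w : L2 Ω) :
    hsNormSq Ω s (u + w) ≤ 2 * hsNormSq Ω s u + 2 * hsNormSq Ω s w := by
  refine iSup_le fun n => iSup_le fun lam => iSup_le fun v => iSup_le fun hv =>
    iSup_le fun hev => ?_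
  have hle : ∀ x : L2 Ω, ∑ i, ENNReal.ofReal (lam i ^ s * ⟪v i, x⟫ ^ 2) ≤ hsNormSq Ω s x :=
    fun x => le_iSup_of_le n <| le_iSup_of_le lam <| le_iSup_of_le v <| le_iSup_of_le hv <|
      le_iSup_of_le hev le_rfl
  have h2 : (2 : ℝ≥0∞) = ENNReal.ofReal 2 := by norm_num
  calc ∑ i, ENNReal.ofReal (lam i ^ s * ⟪v i, u + w⟫ ^ 2)
      ≤ ∑ i, (2 * ENNReal.ofReal (lam i ^ s * ⟪v i, u⟫ ^ 2)
          + 2 * ENNReal.ofReal (lam i ^ s * ⟪v i, w⟫ ^ 2)) := by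
        refine Finset.sum_le_sum fun i _ => ?_
        have hl := Real.rpow_nonneg (hev i).nonneg s
        have hm : ∀ t : ℝ, 2 * ENNReal.ofReal t = ENNReal.ofReal (2 * t) := fun t => by
          rw [ENNReal.ofReal_mul (by norm_num), ← h2]
        rw [hm, hm, ← ENNReal.ofReal_add (by positivity) (by positivity)]
        apply ENNReal.ofReal_le_ofReal
        rw [inner_add_right]
        nlinarith [mul_nonneg hl (sq_nonneg (⟪v i, u⟫ - ⟪v i, w⟫))]
    _ = 2 * ∑ i, ENNReal.ofReal (lam i ^ s * ⟪v i, u⟫ ^ 2)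
          + 2 * ∑ i, ENNReal.ofReal (lam i ^ s * ⟪v i, w⟫ ^ 2) := by
        rw [Finset.sum_add_distrib, Finset.mul_sum, Finset.mul_sum]
    _ ≤ _ := by gcongr <;> exact hle _

theorem hsNormSq_smul_le {d : ℕ} (Ω : Set (E d)) (s : ℝ) (c : ℝ) (w : L2 Ω) :
    hsNormSq Ω s (c • w) ≤ ENNReal.ofReal (c ^ 2) * hsNormSq Ω s w := by
  refine iSup_le fun n => iSup_le fun lam => iSup_le fun v => iSup_le fun hv =>
    iSup_le fun hev => ?_
  have hle : ∑ i, ENNReal.ofReal (lam i ^ s * ⟪v i, w⟫ ^ 2) ≤ hsNormSq Ω s w :=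
    le_iSup_of_le n <| le_iSup_of_le lam <| le_iSup_of_le v <| le_iSup_of_le hv <|
      le_iSup_of_le hev le_rfl
  refine le_trans (le_of_eq ?_) (mul_le_mul_right hle _)
  rw [Finset.mul_sum]
  refine Finset.sum_congr rfl fun i _ => ?_
  rw [← ENNReal.ofReal_mul (sq_nonneg c), inner_smul_right]
  congr 1
  ring

/-- The fractional Sobolev space `ℍ^s(Ω)`, as a subspace of `L²(Ω)`. -/
def Hs {d : ℕ} (Ω : Set (E d)) (s : ℝ) : Submodule ℝ (L2 Ω) where
  carrier := {w | hsNormSq Ω s w < ⊤}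
  zero_mem' := by
    have h := hsNormSq_smul_le Ω s 0 0
    simp at h
    simp [h]
  add_mem' := by
    intro u w hu hw
    refine (hsNormSq_add_le Ω s u w).trans_lt ?_
    exact ENNReal.add_lt_top.2 ⟨ENNReal.mul_lt_top (by norm_num) hu,
      ENNReal.mul_lt_top (by norm_num) hw⟩
  smul_mem' := by
    intro c w hw
    exact (hsNormSq_smul_le Ω s c w).trans_lt (ENNReal.mul_lt_top ENNReal.ofReal_lt_top hw)

/-- `f ∈ ℍ^{-s}(Ω)`: the linear functional `f` on `ℍ^s(Ω)` is bounded. -/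
def IsHsDual {d : ℕ} (Ω : Set (E d)) (s : ℝ) (f : Hs Ω s →ₗ[ℝ] ℝ) : Prop :=
  ∃ C : ℝ, ∀ w : Hs Ω s, |f w| ≤ C * √(hsNormSq Ω s w).toReal

open Classical in
/-- The duality pairing `⟨f, g⟩` for `g ∈ ℍ^s(Ω)` (and `0` for all other `g ∈ L²(Ω)`). -/
def pairing {d : ℕ} (Ω : Set (E d)) (s : ℝ) (f : Hs Ω s →ₗ[ℝ] ℝ) (g : L2 Ω) : ℝ :=
  if h : g ∈ Hs Ω s then f ⟨g, h⟩ else 0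

/-! ### Weighted spaces on the cylinder `𝒞 = Ω × (0,∞)` -/

/-- The exponent `α = 1 - 2s`. -/
def alpha (s : ℝ) : ℝ := 1 - 2 * s

/-- The constant `d_s = 2^{1-2s} Γ(1-s) / Γ(s)`. -/
def ds (s : ℝ) : ℝ := (2 : ℝ) ^ (1 - 2 * s) * Real.Gamma (1 - s) / Real.Gamma s

/-- The measure `y^α dx' dy` on `𝒞`. -/
def cyl {d : ℕ} (Ω : Set (E d)) (s : ℝ) : Measure (E d × ℝ) :=
  (volume.restrict Ω).prod
    ((volume.restrict (Ioi (0 : ℝ))).withDensity fun y => ENNReal.ofReal (y ^ alpha s))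

/-- Triples `(w, G, g)` in `L²(y^α, 𝒞) × L²(y^α, 𝒞; ℝ^d) × L²(y^α, 𝒞)`, with the norm
`(‖w‖² + ‖G‖² + ‖g‖²)^{1/2}`; `G` and `g` stand for `∇_{x'} w` and `∂_y w`. -/
abbrev Cyl {d : ℕ} (Ω : Set (E d)) (s : ℝ) : Type :=
  WithLp 2 (Lp ℝ 2 (cyl Ω s) × WithLp 2 (Lp (E d) 2 (cyl Ω s) × Lp ℝ 2 (cyl Ω s)))

/-- The function `w`. -/
abbrev Cyl.val {d : ℕ} {Ω : Set (E d)} {s : ℝ} (w : Cyl Ω s) : Lp ℝ 2 (cyl Ω s) := w.fst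

/-- The horizontal part `∇_{x'} w` of the gradient. -/
abbrev Cyl.gx {d : ℕ} {Ω : Set (E d)} {s : ℝ} (w : Cyl Ω s) : Lp (E d) 2 (cyl Ω s) := w.snd.fst

/-- The vertical part `∂_y w` of the gradient. -/
abbrev Cyl.gy {d : ℕ} {Ω : Set (E d)} {s : ℝ} (w : Cyl Ω s) : Lp ℝ 2 (cyl Ω s) := w.snd.snd

/-- The classical gradient in `x'`. -/
def gradX {d : ℕ} (φ : E d × ℝ → ℝ) (z : E d × ℝ) : E d := gradient (fun x => φ (x, z.2)) z.1

/-- The classical derivative in `y`. -/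
def derivY {d : ℕ} (φ : E d × ℝ → ℝ) (z : E d × ℝ) : ℝ := deriv (fun y => φ (z.1, y)) z.2

/-- The weighted Sobolev space `H¹(y^α, 𝒞)`: each element is listed together with its
distributional gradient in the open set `𝒞`. -/
def H1w {d : ℕ} (Ω : Set (E d)) (s : ℝ) : Set (Cyl Ω s) :=
  {w | ∀ ψ : E d × ℝ → ℝ, ContDiff ℝ ∞ ψ → HasCompactSupport ψ →
    tsupport ψ ⊆ Ω ×ˢ Ioi (0 : ℝ) →
    (∫ z in Ω ×ˢ Ioi (0 : ℝ), w.val z • gradX ψ z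
        = - ∫ z in Ω ×ˢ Ioi (0 : ℝ), ψ z • w.gx z) ∧
    (∫ z in Ω ×ˢ Ioi (0 : ℝ), w.val z * derivY ψ z
        = - ∫ z in Ω ×ˢ Ioi (0 : ℝ), ψ z * w.gy z)}

/-- `φ` is smooth with compact support in `Ω × ℝ`; thus it is smooth up to `y = 0`, and it vanishes
near the lateral boundary `∂Ω × (0,∞)`. -/
def IsCylTest {d : ℕ} (Ω : Set (E d)) (φ : E d × ℝ → ℝ) : Prop :=
  ContDiff ℝ ∞ φ ∧ HasCompactSupport φ ∧ tsupport φ ⊆ Ω ×ˢ (univ : Set ℝ)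

/-- `w` is the restriction to `𝒞` of the smooth function `φ`, with its classical gradient. -/
def Represents {d : ℕ} {Ω : Set (E d)} {s : ℝ} (φ : E d × ℝ → ℝ) (w : Cyl Ω s) : Prop :=
  w.val =ᵐ[cyl Ω s] φ ∧ w.gx =ᵐ[cyl Ω s] gradX φ ∧ w.gy =ᵐ[cyl Ω s] derivY φ

/-- The space of the `w ∈ H¹(y^α, 𝒞)` with `w = 0` on the lateral boundary `∂Ω × (0,∞)`, that is,
the `w` which are limits in `H¹(y^α, 𝒞)` of smooth functions vanishing near that boundary. -/
def HL {d : ℕ} (Ω : Set (E d)) (s : ℝ) : Set (Cyl Ω s) :=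
  H1w Ω s ∩ closure {w | ∃ φ, IsCylTest Ω φ ∧ Represents φ w}

/-- `g` is the trace of `w` on `Ω × {0}`: there are smooth functions converging to `w` in
`H¹(y^α, 𝒞)` whose restrictions to `Ω × {0}` converge to `g` in `L²(Ω)`. -/
def IsTrace {d : ℕ} {Ω : Set (E d)} {s : ℝ} (w : Cyl Ω s) (g : L2 Ω) : Prop :=
  (w, g) ∈ closure {r : Cyl Ω s × L2 Ω | ∃ φ, IsCylTest Ω φ ∧ Represents φ r.1 ∧
    r.2 =ᵐ[volume.restrict Ω] fun x => φ (x, 0)}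

open Classical in
/-- The trace `tr w ∈ L²(Ω)` of `w` on `Ω × {0}`. -/
def tr {d : ℕ} {Ω : Set (E d)} {s : ℝ} (w : Cyl Ω s) : L2 Ω :=
  if h : ∃ g, IsTrace w g then h.choose else 0

/-! ### State, cost functional, adjoint state -/

/-- The bilinear form `a(w, φ)(q) = ∫_𝒞 y^α (diag{A,1} ∇w · ∇φ + q w φ) dx' dy`. -/
def form {d : ℕ} {Ω : Set (E d)} {s : ℝ} (A : E d → Matrix (Fin d) (Fin d) ℝ) (q : E d → ℝ)
    (w φ : Cyl Ω s) : ℝ :=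
  ∫ z, (⟪(A z.1).toEuclideanLin (w.gx z), φ.gx z⟫ + w.gy z * φ.gy z
    + q z.1 * w.val z * φ.val z) ∂(cyl Ω s)

/-- `u` is a weak solution of the extended problem with coefficient `q`. -/
def IsState {d : ℕ} {Ω : Set (E d)} {s : ℝ} (A : E d → Matrix (Fin d) (Fin d) ℝ)
    (f : Hs Ω s →ₗ[ℝ] ℝ) (q : E d → ℝ) (u : Cyl Ω s) : Prop :=
  u ∈ HL Ω s ∧ ∀ φ ∈ HL Ω s, form A q u φ = ds s * pairing Ω s f (tr φ)

open Classical in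
/-- The extended coefficient-to-solution operator `q ↦ E(q)`. -/
def state {d : ℕ} {Ω : Set (E d)} {s : ℝ} (A : E d → Matrix (Fin d) (Fin d) ℝ)
    (f : Hs Ω s →ₗ[ℝ] ℝ) (q : E d → ℝ) : Cyl Ω s :=
  if h : ∃ u, IsState A f q u then h.choose else 0

/-- The cost functional `𝒥(q) = ½ ‖tr E(q) - z‖²_{L²(Ω)} + (ρ/2) ‖q - q*‖²_{L²(Ω)}`. -/
def cost {d : ℕ} {Ω : Set (E d)} {s : ℝ} (A : E d → Matrix (Fin d) (Fin d) ℝ)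
    (f : Hs Ω s →ₗ[ℝ] ℝ) (z : L2 Ω) (ρ : ℝ) (qstar q : E d → ℝ) : ℝ :=
  1 / 2 * ‖tr (state A f q) - z‖ ^ 2 + ρ / 2 * ∫ x in Ω, (q x - qstar x) ^ 2

/-- `P` is a weak solution of the adjoint problem with coefficient `q`. -/
def IsAdjoint {d : ℕ} {Ω : Set (E d)} {s : ℝ} (A : E d → Matrix (Fin d) (Fin d) ℝ)
    (f : Hs Ω s →ₗ[ℝ] ℝ) (z : L2 Ω) (q : E d → ℝ) (P : Cyl Ω s) : Prop :=
  P ∈ HL Ω s ∧ ∀ w ∈ HL Ω s, form A q w P = ds s * ⟪tr (state A f q) - z, tr w⟫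

open Classical in
/-- The adjoint state `𝒫(q)`. -/
def adjointState {d : ℕ} {Ω : Set (E d)} {s : ℝ} (A : E d → Matrix (Fin d) (Fin d) ℝ)
    (f : Hs Ω s →ₗ[ℝ] ℝ) (z : L2 Ω) (q : E d → ℝ) : Cyl Ω s :=
  if h : ∃ P, IsAdjoint A f z q P then h.choose else 0

/-- `𝚎(q)(x') = ∫_0^∞ y^α E(q)(x',y)² dy`. -/
def eFun {d : ℕ} {Ω : Set (E d)} {s : ℝ} (A : E d → Matrix (Fin d) (Fin d) ℝ)
    (f : Hs Ω s →ₗ[ℝ] ℝ) (q : E d → ℝ) (x : E d) : ℝ :=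
  ∫ y in Ioi (0 : ℝ), y ^ alpha s * (state A f q).val (x, y) ^ 2

/-- `𝔭(q)(x') = -(1/d_s) ∫_0^∞ y^α E(q)(x',y) 𝒫(q)(x',y) dy`. -/
def pFun {d : ℕ} {Ω : Set (E d)} {s : ℝ} (A : E d → Matrix (Fin d) (Fin d) ℝ)
    (f : Hs Ω s →ₗ[ℝ] ℝ) (z : L2 Ω) (q : E d → ℝ) (x : E d) : ℝ :=
  -(1 / ds s) * ∫ y in Ioi (0 : ℝ),
    y ^ alpha s * (state A f q).val (x, y) * (adjointState A f z q).val (x, y)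

end FracIdent

end

/-!
The theorem is the first-order optimality condition for the minimization of `cost` over the convex
set `admissible Ω qbar`, with the derivative of the state eliminated by the adjoint state.

*Solvability.* The space `HL Ω s` is a closed subspace of the Hilbert space `Cyl Ω s`
(`coe_HLsub`, `completeSpace_HLsub`). The form is bounded, and coercive uniformly in the admissible
coefficients because of the Poincaré inequality in the horizontal variables (`exists_coercive`).
By the Lax–Milgram theorem (`existsUnique_of_coercive`) the state and the adjoint state exist and
are unique, as soon as the right-hand sides are bounded functionals on `HL Ω s`.

*Traces.* The boundedness of the right-hand sides amounts to that of the trace `HL → ℍ^s(Ω)`. Its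
heart is the one-dimensional inequality `λ^s g(0)² ≤ C ∫ y^α (λ g² + g'²) dy` with a constant `C`
that does not depend on `λ` (`rpow_mul_sq_le`). For a smooth function `φ` it is applied with
`λ = λᵢ` to the coefficient `g(y) = (vᵢ, φ(·, y))` of each eigenfunction `vᵢ` of a finite
orthonormal system. The gradients of the `vᵢ` are orthogonal with `‖∇vᵢ‖² = λᵢ`, so Bessel's
inequality bounds the sum over `i` by `C ‖φ‖²` (`Represents.sum_trace_le`). No completeness of the
system of eigenfunctions is needed. Both this bound and the one in `L²(Ω)` pass to the closure of
the graph of the trace on smooth functions, so that graph closure is the graph of a bounded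
operator.

*Optimality.* Let `h = q - q₀` and `δ = E(q₀ + t h) - E(q₀)`. Then
`a(δ, φ)(q₀) = -t ∫ y^α h E(q₀ + t h) φ`, so coercivity gives `‖δ‖ = O(t)`
(`exists_norm_state_sub_le`), and testing the adjoint problem with `δ` gives
`(tr E(q₀) - z, tr δ) = -(t / d_s) ∫ y^α h E(q₀) 𝒫(q₀) + O(t²)` (`exists_inner_tr_sub_le`).
Dividing `cost (q₀ + t h) - cost q₀ ≥ 0` by `t` and letting `t → 0` proves
`variational_inequality`; by Fubini's theorem the integral over the cylinder is `(𝔭(q₀), h)`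
(`integral_pFun_mul`). The boundedness of `∫ y^α E(q₀)² dy` enters through `𝔭(q₀) ∈ L²(Ω)` only
(`memLp_pFun`).
-/

namespace FracIdent

/-! ### The weight `y^α` on the half-line and the one-dimensional trace inequality -/

/-- The measure `y^α dy` on `(0,∞)`, the vertical factor of `cyl Ω s`. -/
noncomputable def wt (s : ℝ) : Measure ℝ :=
  (volume.restrict (Ioi (0 : ℝ))).withDensity fun y => ENNReal.ofReal (y ^ alpha s)

instance (s : ℝ) : SigmaFinite (wt s) := SigmaFinite.withDensity_ofReal _

theorem cyl_eq_prod {d : ℕ} (Ω : Set (E d)) (s : ℝ) :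
    cyl Ω s = (volume.restrict Ω).prod (wt s) := rfl

instance {d : ℕ} (Ω : Set (E d)) (s : ℝ) : SigmaFinite (cyl Ω s) :=
  inferInstanceAs (SigmaFinite ((volume.restrict Ω).prod (wt s)))

theorem measurable_weight (s : ℝ) : Measurable fun y : ℝ => ENNReal.ofReal (y ^ alpha s) :=
  (measurable_id.pow_const _).ennreal_ofReal

theorem integral_wt (s : ℝ) (f : ℝ → ℝ) :
    ∫ y, f y ∂(wt s) = ∫ y in Ioi (0 : ℝ), y ^ alpha s * f y := by
  rw [wt, integral_withDensity_eq_integral_toReal_smul (measurable_weight s)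
    (by simp)]
  refine setIntegral_congr_fun measurableSet_Ioi fun y hy => ?_
  simp only [smul_eq_mul]
  rw [ENNReal.toReal_ofReal (Real.rpow_nonneg (le_of_lt hy) _)]

theorem integrable_wt_iff (s : ℝ) (f : ℝ → ℝ) :
    Integrable f (wt s) ↔ IntegrableOn (fun y => y ^ alpha s * f y) (Ioi 0) := by
  rw [wt, integrable_withDensity_iff_integrable_smul' (measurable_weight s) (by simp)]
  refine integrable_congr ?_
  filter_upwards [ae_restrict_mem measurableSet_Ioi] with y hy
  simp only [smul_eq_mul]
  rw [ENNReal.toReal_ofReal (Real.rpow_nonneg (le_of_lt hy) _)]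

theorem isFiniteMeasureOnCompacts_wt {s : ℝ} (hs : s < 1) : IsFiniteMeasureOnCompacts (wt s) := by
  refine ⟨fun K hK => ?_⟩
  obtain ⟨R, hR⟩ := hK.isBounded.subset_closedBall 0
  have hsub : K ∩ Ioi 0 ⊆ Ioc 0 (max R 0) := fun y hy => by
    have := hR hy.1
    rw [Real.closedBall_eq_Icc] at this
    exact ⟨hy.2, le_max_of_le_left (by simpa using this.2)⟩
  have hint : IntegrableOn (fun y : ℝ => y ^ alpha s) (Ioc 0 (max R 0)) :=
    (intervalIntegrable_iff_integrableOn_Ioc_of_le (le_max_right _ _)).1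
      (intervalIntegral.intervalIntegrable_rpow' (by unfold alpha; linarith))
  rw [wt, withDensity_apply _ hK.measurableSet, Measure.restrict_restrict hK.measurableSet]
  exact (lintegral_mono' (Measure.restrict_mono hsub le_rfl) le_rfl).trans_lt
    hint.lintegral_lt_top

theorem isFiniteMeasureOnCompacts_cyl {d : ℕ} (Ω : Set (E d)) {s : ℝ} (hs : s < 1) :
    IsFiniteMeasureOnCompacts (cyl Ω s) := by
  have := isFiniteMeasureOnCompacts_wt hs
  rw [cyl_eq_prod]
  infer_instance

/-- The constant of the one-dimensional trace inequality; averaging gives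
`max (4 - 4 * s) (1 / s)`, which is smaller. -/
noncomputable def traceConst (s : ℝ) : ℝ := 4 + 1 / s

theorem traceConst_pos {s : ℝ} (hs : 0 < s) : 0 < traceConst s := by
  unfold traceConst; positivity

/-- Cauchy–Schwarz for `|h| = y^{-α/2} · y^{α/2} |h|` on `(0, T)`. -/
theorem sq_integral_abs_le {s : ℝ} (hs : 0 < s) {h : ℝ → ℝ}
    (hh : Integrable (fun y => h y ^ 2) (wt s)) {T : ℝ} (hT : 0 < T)
    (hhT : IntervalIntegrable h volume 0 T) :
    (∫ y in (0)..T, |h y|) ^ 2 ≤ T ^ (2 * s) / (2 * s) * ∫ y, h y ^ 2 ∂(wt s) := by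
  have hh' := (integrable_wt_iff s _).1 hh
  have hI : 0 ≤ ∫ y, h y ^ 2 ∂(wt s) := integral_nonneg fun y => sq_nonneg _
  have hle : ∫ y in Ioc 0 T, y ^ alpha s * h y ^ 2 ≤ ∫ y, h y ^ 2 ∂(wt s) := by
    rw [integral_wt]
    refine setIntegral_mono_set hh' ?_ (Ioc_subset_Ioi_self.eventuallyLE)
    filter_upwards [ae_restrict_mem measurableSet_Ioi] with y hy
    exact mul_nonneg (Real.rpow_nonneg (le_of_lt hy) _) (sq_nonneg _)
  have hexp : -1 < -alpha s := by unfold alpha; linarith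
  have ha : ∫ y in (0)..T, y ^ (-alpha s) = T ^ (2 * s) / (2 * s) := by
    rw [integral_rpow (Or.inl hexp)]
    have : -alpha s + 1 = 2 * s := by unfold alpha; ring
    rw [this, Real.zero_rpow (by positivity), sub_zero]
  have hpos : 0 < T ^ (2 * s) / (2 * s) := by positivity
  have hw : IntervalIntegrable (fun y : ℝ => y ^ (-alpha s)) volume 0 T :=
    intervalIntegral.intervalIntegrable_rpow' hexp
  have hh2 : IntervalIntegrable (fun y : ℝ => y ^ alpha s * h y ^ 2) volume 0 T :=
    (intervalIntegrable_iff_integrableOn_Ioc_of_le hT.le).2 (hh'.mono_set Ioc_subset_Ioi_self)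
  set X := ∫ y in (0)..T, |h y|
  set I := ∫ y, h y ^ 2 ∂(wt s)
  have hX : 0 ≤ X := intervalIntegral.integral_nonneg hT.le fun _ _ => abs_nonneg _
  have key : ∀ ε : ℝ, 0 < ε → 2 * X ≤ ε * (T ^ (2 * s) / (2 * s)) + ε⁻¹ * I := by
    intro ε hε
    calc 2 * X = ∫ y in (0)..T, 2 * |h y| := by rw [intervalIntegral.integral_const_mul]
      _ ≤ ∫ y in (0)..T, (ε * y ^ (-alpha s) + ε⁻¹ * (y ^ alpha s * h y ^ 2)) := by
          refine intervalIntegral.integral_mono_on_of_le_Ioo hT.le (hhT.abs.const_mul 2)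
            ((hw.const_mul ε).add (hh2.const_mul _)) fun y hy => ?_
          have hy0 : 0 < y ^ alpha s := Real.rpow_pos_of_pos hy.1 _
          rw [Real.rpow_neg hy.1.le, ← sq_abs (h y)]
          have : ε * (y ^ alpha s)⁻¹ + ε⁻¹ * (y ^ alpha s * |h y| ^ 2) - 2 * |h y|
              = ε * (y ^ alpha s)⁻¹ * (1 - ε⁻¹ * y ^ alpha s * |h y|) ^ 2 := by
            field_simp; ring
          have h2 : 0 ≤ ε * (y ^ alpha s)⁻¹ * (1 - ε⁻¹ * y ^ alpha s * |h y|) ^ 2 := by positivity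
          linarith
      _ = ε * (T ^ (2 * s) / (2 * s)) + ε⁻¹ * ∫ y in (0)..T, y ^ alpha s * h y ^ 2 := by
          rw [intervalIntegral.integral_add (hw.const_mul ε) (hh2.const_mul _),
            intervalIntegral.integral_const_mul, intervalIntegral.integral_const_mul, ha]
      _ ≤ _ := by
          rw [intervalIntegral.integral_of_le hT.le]
          gcongr
  rcases hX.eq_or_lt with h0 | h0
  · rw [← h0]; simp only [ne_eq, OfNat.ofNat_ne_zero, not_false_eq_true, zero_pow]
    positivity
  -- the optimal choice of `ε`
  have h1 := key (X / (T ^ (2 * s) / (2 * s))) (by positivity)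
  rw [div_mul_cancel₀ _ hpos.ne', inv_div] at h1
  have h2 : X ≤ T ^ (2 * s) / (2 * s) / X * I := by linarith
  calc X ^ 2 = X * X := sq X
    _ ≤ X * (T ^ (2 * s) / (2 * s) / X * I) := by gcongr
    _ = _ := by field_simp

/-- The scaled trace inequality on the half-line:
`λ^s g(0)² ≤ C ∫ y^α (λ g² + h²) dy` where `h = g'`. It results from averaging
`g(0)² ≤ 2 g(t)² + 2 (∫₀ᵗ |h|)²` over `0 < t < λ^{-1/2}` with the weight `t^α`. -/
theorem rpow_mul_sq_le {s : ℝ} (hs : s ∈ Ioo (0 : ℝ) 1) {g h : ℝ → ℝ}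
    (hg : Integrable (fun y => g y ^ 2) (wt s)) (hh : Integrable (fun y => h y ^ 2) (wt s))
    (hhi : ∀ T, 0 < T → IntervalIntegrable h volume 0 T)
    (hgh : ∀ t, 0 < t → g t - g 0 = ∫ y in (0)..t, h y) {lam : ℝ} (hlam : 0 < lam) :
    lam ^ s * g 0 ^ 2 ≤
      traceConst s * (lam * (∫ y, g y ^ 2 ∂(wt s)) + ∫ y, h y ^ 2 ∂(wt s)) := by
  obtain ⟨hs0, hs1⟩ := hs
  -- the length scale at which `λ g²` and `g'²` balance
  set T : ℝ := lam ^ (-(1 / 2) : ℝ) with hTdef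
  have hT : 0 < T := Real.rpow_pos_of_pos hlam _
  have hg' := (integrable_wt_iff s _).1 hg
  set I₀ := ∫ y, g y ^ 2 ∂(wt s) with hI₀
  set I₁ := ∫ y, h y ^ 2 ∂(wt s) with hI₁
  have hI₀nn : 0 ≤ I₀ := integral_nonneg fun y => sq_nonneg _
  have hI₁nn : 0 ≤ I₁ := integral_nonneg fun y => sq_nonneg _
  have hX := sq_integral_abs_le hs0 hh hT (hhi T hT)
  rw [← hI₁] at hX
  set a := T ^ (2 * s) / (2 * s) with hadef
  have hexp : -1 < alpha s := by unfold alpha; linarith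
  have hm : ∫ y in (0)..T, y ^ alpha s = T ^ (2 - 2 * s) / (2 - 2 * s) := by
    rw [integral_rpow (Or.inl hexp)]
    have : alpha s + 1 = 2 - 2 * s := by unfold alpha; ring
    rw [this, Real.zero_rpow (by linarith), sub_zero]
  set m := T ^ (2 - 2 * s) / (2 - 2 * s) with hmdef
  have hmpos : 0 < m := div_pos (Real.rpow_pos_of_pos hT _) (by linarith)
  have hle : ∫ y in (0)..T, y ^ alpha s * g y ^ 2 ≤ I₀ := by
    rw [hI₀, integral_wt, intervalIntegral.integral_of_le hT.le]
    refine setIntegral_mono_set hg' ?_ (Ioc_subset_Ioi_self.eventuallyLE)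
    filter_upwards [ae_restrict_mem measurableSet_Ioi] with y hy
    exact mul_nonneg (Real.rpow_nonneg (le_of_lt hy) _) (sq_nonneg _)
  have hpt : ∀ t ∈ Ioo 0 T, g 0 ^ 2 ≤ 2 * g t ^ 2 + 2 * (a * I₁) := by
    intro t ht
    have h1 : |g t - g 0| ≤ ∫ y in (0)..T, |h y| := by
      rw [hgh t ht.1]
      refine (intervalIntegral.abs_integral_le_integral_abs ht.1.le).trans ?_
      exact intervalIntegral.integral_mono_interval le_rfl ht.1.le ht.2.le
        (Filter.Eventually.of_forall fun _ => abs_nonneg _) (hhi T hT).abs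
    have h2 : (g t - g 0) ^ 2 ≤ a * I₁ := by
      rw [← sq_abs]
      exact (pow_le_pow_left₀ (abs_nonneg _) h1 2).trans hX
    nlinarith [sq_nonneg (2 * g t - g 0)]
  have hw : IntervalIntegrable (fun y : ℝ => y ^ alpha s) volume 0 T :=
    intervalIntegral.intervalIntegrable_rpow' hexp
  have hg2 : IntervalIntegrable (fun y : ℝ => y ^ alpha s * g y ^ 2) volume 0 T :=
    (intervalIntegrable_iff_integrableOn_Ioc_of_le hT.le).2 (hg'.mono_set Ioc_subset_Ioi_self)
  have hmain : m * g 0 ^ 2 ≤ 2 * I₀ + m * (2 * (a * I₁)) := by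
    calc m * g 0 ^ 2 = ∫ y in (0)..T, y ^ alpha s * g 0 ^ 2 := by
          rw [intervalIntegral.integral_mul_const, hm]
      _ ≤ ∫ y in (0)..T, (2 * (y ^ alpha s * g y ^ 2) + y ^ alpha s * (2 * (a * I₁))) := by
          refine intervalIntegral.integral_mono_on_of_le_Ioo hT.le (hw.mul_const _)
            ((hg2.const_mul 2).add (hw.mul_const _)) fun y hy => ?_
          have hy0 : 0 ≤ y ^ alpha s := Real.rpow_nonneg hy.1.le _
          have := mul_le_mul_of_nonneg_left (hpt y hy) hy0
          linarith
      _ = 2 * (∫ y in (0)..T, y ^ alpha s * g y ^ 2) + m * (2 * (a * I₁)) := by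
          rw [intervalIntegral.integral_add (hg2.const_mul 2) (hw.mul_const _),
            intervalIntegral.integral_const_mul, intervalIntegral.integral_mul_const, hm]
      _ ≤ _ := by gcongr
  have hla : lam ^ s * a = 1 / (2 * s) := by
    have h1 : T ^ (2 * s) = (lam ^ s)⁻¹ := by
      rw [hTdef, ← Real.rpow_mul hlam.le, ← Real.rpow_neg hlam.le]; congr 1; ring
    have h2 : lam ^ s ≠ 0 := (Real.rpow_pos_of_pos hlam _).ne'
    rw [hadef, h1]; field_simp
  have hlm : lam ^ s = (2 - 2 * s) * lam * m := by
    have h1 : T ^ (2 - 2 * s) = lam ^ (s - 1) := by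
      rw [hTdef, ← Real.rpow_mul hlam.le]; congr 1; ring
    have h2 : lam ^ s = lam * lam ^ (s - 1) := by
      rw [Real.rpow_sub_one hlam.ne']; field_simp
    have h3 : (2 - 2 * s) ≠ 0 := by linarith
    rw [hmdef, h1, h2]; field_simp
  have hfin : lam ^ s * g 0 ^ 2 ≤ (4 - 4 * s) * (lam * I₀) + 1 / s * I₁ := by
    have h1 : (2 - 2 * s) * lam * (m * g 0 ^ 2)
        ≤ (2 - 2 * s) * lam * (2 * I₀ + m * (2 * (a * I₁))) := by
      refine mul_le_mul_of_nonneg_left hmain (mul_nonneg (by linarith) hlam.le)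
    have h2 : (2 - 2 * s) * lam * (2 * I₀ + m * (2 * (a * I₁)))
        = (4 - 4 * s) * (lam * I₀) + 2 * (((2 - 2 * s) * lam * m) * a) * I₁ := by ring
    have h3 : 2 * (1 / (2 * s)) = 1 / s := by field_simp
    rw [h2, ← hlm, hla, h3] at h1
    calc lam ^ s * g 0 ^ 2 = (2 - 2 * s) * lam * (m * g 0 ^ 2) := by rw [hlm]; ring
      _ ≤ _ := h1
  refine hfin.trans ?_
  have hs' : 0 ≤ 1 / s := by positivity
  have hlI : 0 ≤ lam * I₀ := by positivity
  unfold traceConst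
  nlinarith [mul_nonneg hs' hlI, mul_nonneg hs0.le hlI]

/-! ### Smooth test functions and their slices -/

section Calculus

variable {d : ℕ}

theorem hasCompactSupport_sq {X : Type*} [TopologicalSpace X] {f : X → ℝ}
    (h : HasCompactSupport f) : HasCompactSupport fun x => f x ^ 2 :=
  h.mono fun x hx h0 => hx (by simp [h0])

theorem inner_gradient {φ : E d → ℝ} (x v : E d) : ⟪gradient φ x, v⟫ = fderiv ℝ φ x v := by
  rw [gradient, InnerProductSpace.toDual_symm_apply]

theorem continuous_gradient {φ : E d → ℝ} (hφ : ContDiff ℝ ∞ φ) : Continuous (gradient φ) :=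
  (InnerProductSpace.toDual ℝ (E d)).symm.continuous.comp (hφ.continuous_fderiv (by simp))

theorem hasCompactSupport_gradient {φ : E d → ℝ} (hφ : HasCompactSupport φ) :
    HasCompactSupport (gradient φ) :=
  (hφ.fderiv ℝ).comp_left (g := (InnerProductSpace.toDual ℝ (E d)).symm) (map_zero _)

theorem hasFDerivAt_slice {φ : E d × ℝ → ℝ} (hφ : ContDiff ℝ ∞ φ) (z : E d × ℝ) :
    HasFDerivAt (fun x => φ (x, z.2))
      ((fderiv ℝ φ z).comp (ContinuousLinearMap.inl ℝ (E d) ℝ)) z.1 := by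
  have h1 : HasFDerivAt φ (fderiv ℝ φ z) (z.1, z.2) :=
    (hφ.differentiable (by simp) z).hasFDerivAt
  exact h1.comp z.1 (hasFDerivAt_prodMk_left z.1 z.2)

theorem hasDerivAt_slice {φ : E d × ℝ → ℝ} (hφ : ContDiff ℝ ∞ φ) (z : E d × ℝ) :
    HasDerivAt (fun y => φ (z.1, y)) (fderiv ℝ φ z (0, 1)) z.2 := by
  have h1 : HasFDerivAt φ (fderiv ℝ φ z) (z.1, z.2) :=
    (hφ.differentiable (by simp) z).hasFDerivAt
  have h2 := (h1.comp z.2 (hasFDerivAt_prodMk_right z.1 z.2)).hasDerivAt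
  simp only [ContinuousLinearMap.comp_apply, ContinuousLinearMap.inr_apply] at h2
  exact h2

theorem gradX_eq {φ : E d × ℝ → ℝ} (hφ : ContDiff ℝ ∞ φ) :
    gradX φ = fun z => (InnerProductSpace.toDual ℝ (E d)).symm
      ((fderiv ℝ φ z).comp (ContinuousLinearMap.inl ℝ (E d) ℝ)) := by
  funext z
  rw [gradX, gradient, (hasFDerivAt_slice hφ z).fderiv]

theorem derivY_eq {φ : E d × ℝ → ℝ} (hφ : ContDiff ℝ ∞ φ) :
    derivY φ = fun z => fderiv ℝ φ z (0, 1) := by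
  funext z
  rw [derivY, (hasDerivAt_slice hφ z).deriv]

theorem continuous_gradX {φ : E d × ℝ → ℝ} (hφ : ContDiff ℝ ∞ φ) : Continuous (gradX φ) := by
  rw [gradX_eq hφ]
  exact (InnerProductSpace.toDual ℝ (E d)).symm.continuous.comp
    ((hφ.continuous_fderiv (by simp)).clm_comp continuous_const)

theorem continuous_derivY {φ : E d × ℝ → ℝ} (hφ : ContDiff ℝ ∞ φ) : Continuous (derivY φ) := by
  rw [derivY_eq hφ]
  exact (hφ.continuous_fderiv (by simp)).clm_apply continuous_const

theorem tsupport_gradX_subset {φ : E d × ℝ → ℝ} (hφ : ContDiff ℝ ∞ φ) :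
    tsupport (gradX φ) ⊆ tsupport φ := by
  rw [gradX_eq hφ]
  refine (closure_mono fun z hz => ?_).trans (tsupport_fderiv_subset ℝ)
  contrapose! hz
  simp only [Function.mem_support, not_not] at hz ⊢
  rw [hz]; simp

theorem tsupport_derivY_subset {φ : E d × ℝ → ℝ} (hφ : ContDiff ℝ ∞ φ) :
    tsupport (derivY φ) ⊆ tsupport φ := by
  rw [derivY_eq hφ]
  refine (closure_mono fun z hz => ?_).trans (tsupport_fderiv_subset ℝ)
  contrapose! hz
  simp only [Function.mem_support, not_not] at hz ⊢
  rw [hz]; simp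

theorem hasCompactSupport_gradX {φ : E d × ℝ → ℝ} (hφ : ContDiff ℝ ∞ φ)
    (hc : HasCompactSupport φ) : HasCompactSupport (gradX φ) :=
  hc.of_isClosed_subset (isClosed_tsupport _) (tsupport_gradX_subset hφ)

theorem hasCompactSupport_derivY {φ : E d × ℝ → ℝ} (hφ : ContDiff ℝ ∞ φ)
    (hc : HasCompactSupport φ) : HasCompactSupport (derivY φ) :=
  hc.of_isClosed_subset (isClosed_tsupport _) (tsupport_derivY_subset hφ)

theorem gradX_add {φ ψ : E d × ℝ → ℝ} (hφ : ContDiff ℝ ∞ φ) (hψ : ContDiff ℝ ∞ ψ) :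
    gradX (φ + ψ) = gradX φ + gradX ψ := by
  rw [gradX_eq hφ, gradX_eq hψ, gradX_eq (φ := φ + ψ) (hφ.add hψ)]
  funext z
  have h := fderiv_add (hφ.differentiable (by simp) z) (hψ.differentiable (by simp) z)
  simp [h]

theorem derivY_add {φ ψ : E d × ℝ → ℝ} (hφ : ContDiff ℝ ∞ φ) (hψ : ContDiff ℝ ∞ ψ) :
    derivY (φ + ψ) = derivY φ + derivY ψ := by
  rw [derivY_eq hφ, derivY_eq hψ, derivY_eq (φ := φ + ψ) (hφ.add hψ)]
  funext z
  have h := fderiv_add (hφ.differentiable (by simp) z) (hψ.differentiable (by simp) z)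
  simp [h]

theorem gradX_smul {φ : E d × ℝ → ℝ} (hφ : ContDiff ℝ ∞ φ) (c : ℝ) :
    gradX (c • φ) = c • gradX φ := by
  rw [gradX_eq hφ, gradX_eq (φ := c • φ) (hφ.const_smul c)]
  funext z
  have h := fderiv_const_smul (hφ.differentiable (by simp) z) c
  simp [h]

theorem derivY_smul {φ : E d × ℝ → ℝ} (hφ : ContDiff ℝ ∞ φ) (c : ℝ) :
    derivY (c • φ) = c • derivY φ := by
  rw [derivY_eq hφ, derivY_eq (φ := c • φ) (hφ.const_smul c)]
  funext z
  have h := fderiv_const_smul (hφ.differentiable (by simp) z) c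
  simp [h]

/-- A slice of a compactly supported function has compact support. -/
theorem hasCompactSupport_slice {F : Type*} [Zero F] {φ : E d × ℝ → F} (hc : HasCompactSupport φ)
    (y : ℝ) : HasCompactSupport fun x => φ (x, y) := by
  refine HasCompactSupport.intro (hc.isCompact.image continuous_fst) fun x hx => ?_
  by_contra h
  exact hx ⟨(x, y), subset_tsupport _ h, rfl⟩

theorem hasCompactSupport_slice_right {F : Type*} [Zero F] {φ : E d × ℝ → F}
    (hc : HasCompactSupport φ) (x : E d) : HasCompactSupport fun y => φ (x, y) := by
  refine HasCompactSupport.intro (hc.isCompact.image continuous_snd) fun y hy => ?_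
  by_contra h
  exact hy ⟨(x, y), subset_tsupport _ h, rfl⟩

variable {Ω : Set (E d)}

theorem IsCylTest.isTest_slice {φ : E d × ℝ → ℝ} (hφ : IsCylTest Ω φ) (y : ℝ) :
    IsTest Ω fun x => φ (x, y) := by
  obtain ⟨h1, h2, h3⟩ := hφ
  refine ⟨h1.comp (contDiff_id.prodMk contDiff_const), hasCompactSupport_slice h2 y, ?_⟩
  intro x hx
  exact (h3 (tsupport_comp_subset_preimage φ (f := fun x : E d => (x, y)) (by fun_prop) hx)).1

theorem IsTest.setIntegral_eq {G : Type*} [NormedAddCommGroup G] [NormedSpace ℝ G]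
    {φ : E d → ℝ} (hφ : IsTest Ω φ) {F : E d → G} (hF : ∀ x, x ∉ tsupport φ → F x = 0) :
    ∫ x in Ω, F x = ∫ x, F x :=
  setIntegral_eq_integral_of_forall_compl_eq_zero fun x hx => hF x fun h => hx (hφ.2.2 h)

theorem gradient_eq_zero_of_notMem_tsupport {φ : E d → ℝ} {x : E d} (hx : x ∉ tsupport φ) :
    gradient φ x = 0 := by
  rw [gradient, fderiv_of_notMem_tsupport ℝ hx, map_zero]

/-- Integration by parts for a smooth `φ` against a test function. -/
theorem IsTest.integral_smul_gradient {φ ψ : E d → ℝ} (hφ : IsTest Ω φ) (hψ : IsTest Ω ψ) :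
    ∫ x in Ω, φ x • gradient ψ x = - ∫ x in Ω, ψ x • gradient φ x := by
  rw [hφ.setIntegral_eq fun x hx => by rw [image_eq_zero_of_notMem_tsupport hx, zero_smul],
    hψ.setIntegral_eq fun x hx => by rw [image_eq_zero_of_notMem_tsupport hx, zero_smul]]
  have hi : ∀ {φ ψ : E d → ℝ}, IsTest Ω φ → IsTest Ω ψ →
      Integrable fun x => φ x • gradient ψ x := fun h h' =>
    (h.1.continuous.smul (continuous_gradient h'.1)).integrable_of_hasCompactSupport
      h.2.1.smul_right
  refine ext_inner_right ℝ fun v => ?_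
  rw [inner_neg_left, real_inner_comm, real_inner_comm v, ← integral_inner (hi hφ hψ),
    ← integral_inner (hi hψ hφ)]
  have hg : ∀ (c : ℝ) (φ : E d → ℝ) (x : E d), ⟪v, c • gradient φ x⟫ = c * fderiv ℝ φ x v :=
    fun c φ x => by rw [inner_smul_right, real_inner_comm, inner_gradient]
  simp only [hg]
  have hc : ∀ {φ ψ : E d → ℝ}, IsTest Ω φ → IsTest Ω ψ →
      Integrable fun x => φ x * fderiv ℝ ψ x v := fun h h' =>
    (h.1.continuous.mul ((h'.1.continuous_fderiv (by simp)).clm_apply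
      continuous_const)).integrable_of_hasCompactSupport h.2.1.mul_right
  rw [integral_mul_fderiv_eq_neg_fderiv_mul_of_integrable
    (by simpa only [mul_comm] using hc hψ hφ) (hc hφ hψ)
    ((hφ.1.continuous.mul hψ.1.continuous).integrable_of_hasCompactSupport hφ.2.1.mul_right)
    (fun x _ => hφ.1.differentiable (by simp) x) (fun x _ => hψ.1.differentiable (by simp) x)]
  simp only [mul_comm]

/-- The Poincaré inequality for test functions, by integrating
`φ² = φ² ∂ᵤ⟪u, x⟫` by parts. -/
theorem IsTest.poincare {φ : E d → ℝ} (hφ : IsTest Ω φ) {R : ℝ}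
    (hR : ∀ x ∈ Ω, ‖x‖ ≤ R) {u : E d} (hu : ‖u‖ = 1) :
    ∫ x in Ω, φ x ^ 2 ≤ 4 * R ^ 2 * ∫ x in Ω, ‖gradient φ x‖ ^ 2 := by
  rw [hφ.setIntegral_eq fun x hx => by
      rw [image_eq_zero_of_notMem_tsupport hx, zero_pow two_ne_zero],
    hφ.setIntegral_eq fun x hx => by
      rw [gradient_eq_zero_of_notMem_tsupport hx, norm_zero, zero_pow two_ne_zero]]
  obtain ⟨h1, h2, h3⟩ := hφ
  have hd : ∀ x, fderiv ℝ (fun x => φ x ^ 2) x u = 2 * φ x * ⟪gradient φ x, u⟫ := fun x => by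
    rw [inner_gradient]
    have := ((h1.differentiable (by simp) x).hasFDerivAt.pow 2).fderiv
    rw [this]; simp
  have hl : ∀ x, fderiv ℝ (fun x : E d => ⟪u, x⟫) x u = 1 := fun x => by
    have := (innerSL ℝ u).hasFDerivAt (x := x)
    have h : fderiv ℝ (fun x : E d => ⟪u, x⟫) x = innerSL ℝ u := this.fderiv
    rw [h]; simp [hu]
  have hcφ := h1.continuous
  have hcg := continuous_gradient h1
  have hi1 : Integrable fun x => φ x ^ 2 :=
    (hcφ.pow 2).integrable_of_hasCompactSupport (hasCompactSupport_sq h2)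
  have hi2 : Integrable fun x => ‖gradient φ x‖ ^ 2 :=
    (hcg.norm.pow 2).integrable_of_hasCompactSupport
      (hasCompactSupport_sq (hasCompactSupport_gradient h2).norm)
  have hi3 : Integrable fun x => ⟪u, x⟫ * (2 * φ x * ⟪gradient φ x, u⟫) := by
    refine Continuous.integrable_of_hasCompactSupport (by fun_prop) ?_
    exact HasCompactSupport.mul_left (HasCompactSupport.mul_right h2.mul_left)
  have hi4 : Integrable fun x => ⟪u, x⟫ * φ x ^ 2 := by
    refine Continuous.integrable_of_hasCompactSupport (by fun_prop) ?_
    refine HasCompactSupport.mul_left ?_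
    exact (hasCompactSupport_sq h2)
  have hibp := integral_mul_fderiv_eq_neg_fderiv_mul_of_integrable (μ := (volume : Measure (E d)))
    (f := fun x => ⟪u, x⟫) (g := fun x => φ x ^ 2) (v := u)
    (by simpa only [hl, one_mul] using hi1) (by simpa only [hd] using hi3) hi4
    (fun x _ => (innerSL ℝ u).differentiableAt)
    (fun x _ => (h1.differentiable (by simp) x).pow 2)
  simp only [hl, hd, one_mul] at hibp
  have hle : ∫ x, φ x ^ 2 ≤ ∫ x, (1 / 2 * φ x ^ 2 + 2 * R ^ 2 * ‖gradient φ x‖ ^ 2) := by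
    have : ∫ x, φ x ^ 2 = ∫ x, - (⟪u, x⟫ * (2 * φ x * ⟪gradient φ x, u⟫)) := by
      rw [integral_neg]; linarith
    rw [this]
    refine integral_mono hi3.neg ((hi1.const_mul _).add (hi2.const_mul _)) fun x => ?_
    by_cases hx : x ∈ tsupport φ
    · have hxR := hR x (h3 hx)
      have ha : |⟪u, x⟫| ≤ R := (abs_real_inner_le_norm u x).trans (by rw [hu, one_mul]; exact hxR)
      have hb : |⟪gradient φ x, u⟫| ≤ ‖gradient φ x‖ :=
        (abs_real_inner_le_norm _ _).trans (by rw [hu, mul_one])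
      have hab : |⟪u, x⟫ * ⟪gradient φ x, u⟫| ≤ R * ‖gradient φ x‖ := by
        rw [abs_mul]; gcongr; exact (norm_nonneg x).trans hxR
      have h5 := sq_le_sq' (abs_le.1 hab).1 (abs_le.1 hab).2
      show -(⟪u, x⟫ * (2 * φ x * ⟪gradient φ x, u⟫))
        ≤ 1 / 2 * φ x ^ 2 + 2 * R ^ 2 * ‖gradient φ x‖ ^ 2
      nlinarith [sq_nonneg (φ x + 2 * (⟪u, x⟫ * ⟪gradient φ x, u⟫))]
    · show -(⟪u, x⟫ * (2 * φ x * ⟪gradient φ x, u⟫))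
        ≤ 1 / 2 * φ x ^ 2 + 2 * R ^ 2 * ‖gradient φ x‖ ^ 2
      rw [image_eq_zero_of_notMem_tsupport hx]
      simp; positivity
  rw [integral_add (hi1.const_mul _) (hi2.const_mul _), integral_const_mul,
    integral_const_mul] at hle
  linarith

theorem norm_sq_eq_integral {X F : Type*} [MeasurableSpace X] {μ : Measure X}
    [NormedAddCommGroup F] [InnerProductSpace ℝ F] (u : Lp F 2 μ) {f : X → F} (h : u =ᵐ[μ] f) :
    ‖u‖ ^ 2 = ∫ x, ‖f x‖ ^ 2 ∂μ := by
  rw [← real_inner_self_eq_norm_sq, L2.inner_def]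
  refine integral_congr_ae ?_
  filter_upwards [h] with x hx
  rw [hx, real_inner_self_eq_norm_sq]

theorem inner_eq_integral_mul {X : Type*} [MeasurableSpace X] {μ : Measure X}
    (u v : Lp ℝ 2 μ) {f : X → ℝ} (h : v =ᵐ[μ] f) : ⟪u, v⟫ = ∫ x, u x * f x ∂μ := by
  rw [L2.inner_def]
  refine integral_congr_ae ?_
  filter_upwards [h] with x hx
  rw [hx, real_inner_comm]; rfl

theorem integrable_norm_sq {X F : Type*} [TopologicalSpace X] [MeasurableSpace X]
    [OpensMeasurableSpace X] {μ : Measure X} [IsFiniteMeasureOnCompacts μ] [NormedAddCommGroup F]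
    {f : X → F} (hf : Continuous f) (hc : HasCompactSupport f) :
    Integrable (fun x => ‖f x‖ ^ 2) μ :=
  (hf.norm.pow 2).integrable_of_hasCompactSupport (hasCompactSupport_sq hc.norm)

end Calculus

/-! ### Estimates for test functions on the cylinder -/

section Estimates

variable {d : ℕ} {Ω : Set (E d)} {s : ℝ}

theorem Cyl.norm_sq (w : Cyl Ω s) : ‖w‖ ^ 2 = ‖w.val‖ ^ 2 + ‖w.gx‖ ^ 2 + ‖w.gy‖ ^ 2 := by
  rw [WithLp.prod_norm_sq_eq_of_L2, WithLp.prod_norm_sq_eq_of_L2, add_assoc]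

theorem integral_cyl {F : E d × ℝ → ℝ} (hF : Integrable F (cyl Ω s)) :
    ∫ z, F z ∂(cyl Ω s) = ∫ y, (∫ x in Ω, F (x, y)) ∂(wt s) := by
  rw [cyl_eq_prod] at *
  exact integral_prod_symm F hF

theorem integral_cyl' {F : E d × ℝ → ℝ} (hF : Integrable F (cyl Ω s)) :
    ∫ z, F z ∂(cyl Ω s) = ∫ x in Ω, ∫ y, F (x, y) ∂(wt s) := by
  rw [cyl_eq_prod] at *
  exact integral_prod F hF

/-- The Poincaré inequality in the weighted space, for smooth functions. -/
theorem Represents.poincare (hs : s < 1) {φ : E d × ℝ → ℝ} (hφ : IsCylTest Ω φ) {w : Cyl Ω s}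
    (hw : Represents φ w) {R : ℝ} (hR : ∀ x ∈ Ω, ‖x‖ ≤ R) {u : E d} (hu : ‖u‖ = 1) :
    ‖w.val‖ ^ 2 ≤ 4 * R ^ 2 * ‖w.gx‖ ^ 2 := by
  have := isFiniteMeasureOnCompacts_cyl Ω hs
  have hi1 : Integrable (fun z => ‖φ z‖ ^ 2) (cyl Ω s) :=
    integrable_norm_sq hφ.1.continuous hφ.2.1
  have hi2 : Integrable (fun z => ‖gradX φ z‖ ^ 2) (cyl Ω s) :=
    integrable_norm_sq (continuous_gradX hφ.1) (hasCompactSupport_gradX hφ.1 hφ.2.1)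
  rw [norm_sq_eq_integral _ hw.1, norm_sq_eq_integral _ hw.2.1, integral_cyl hi1,
    integral_cyl hi2, ← integral_const_mul]
  refine integral_mono ?_ (Integrable.const_mul ?_ _) fun y => ?_
  · rw [cyl_eq_prod] at hi1; exact hi1.integral_prod_right
  · rw [cyl_eq_prod] at hi2; exact hi2.integral_prod_right
  · have := (hφ.isTest_slice y).poincare hR hu
    simp only [Real.norm_eq_abs, sq_abs]
    exact this

/-- The trace on `Ω × {0}` is bounded in `L²`, for smooth functions. -/
theorem Represents.trace_le (hs : s ∈ Ioo (0 : ℝ) 1) {φ : E d × ℝ → ℝ} (hφ : IsCylTest Ω φ)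
    {w : Cyl Ω s} (hw : Represents φ w) {g : L2 Ω}
    (hg : g =ᵐ[volume.restrict Ω] fun x => φ (x, 0)) :
    ‖g‖ ^ 2 ≤ traceConst s * ‖w‖ ^ 2 := by
  have := isFiniteMeasureOnCompacts_cyl Ω hs.2
  have := isFiniteMeasureOnCompacts_wt hs.2
  obtain ⟨h1, h2, h3⟩ := hφ
  have hi1 : Integrable (fun z => ‖φ z‖ ^ 2) (cyl Ω s) := integrable_norm_sq h1.continuous h2
  have hi2 : Integrable (fun z => ‖derivY φ z‖ ^ 2) (cyl Ω s) :=
    integrable_norm_sq (continuous_derivY h1) (hasCompactSupport_derivY h1 h2)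
  have hi1' := hi1
  have hi2' := hi2
  rw [cyl_eq_prod] at hi1' hi2'
  have key : ‖g‖ ^ 2 ≤ traceConst s * (‖w.val‖ ^ 2 + ‖w.gy‖ ^ 2) := by
    rw [norm_sq_eq_integral _ hg, norm_sq_eq_integral _ hw.1, norm_sq_eq_integral _ hw.2.2,
      integral_cyl' hi1, integral_cyl' hi2,
      ← integral_add hi1'.integral_prod_left hi2'.integral_prod_left, ← integral_const_mul]
    refine integral_mono ?_ (Integrable.const_mul
      (hi1'.integral_prod_left.add hi2'.integral_prod_left) _) fun x => ?_
    · exact integrable_norm_sq (f := fun x => φ (x, 0)) (h1.continuous.comp (by fun_prop))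
        (hasCompactSupport_slice h2 0)
    · have hcx : Continuous fun y => φ (x, y) := h1.continuous.comp (by fun_prop)
      have hcy : Continuous fun y => derivY φ (x, y) := (continuous_derivY h1).comp (by fun_prop)
      have := rpow_mul_sq_le hs (g := fun y => φ (x, y)) (h := fun y => derivY φ (x, y))
        (by simpa using integrable_norm_sq (μ := wt s) hcx (hasCompactSupport_slice_right h2 x))
        (by simpa using integrable_norm_sq (μ := wt s) hcy
              (hasCompactSupport_slice_right (hasCompactSupport_derivY h1 h2) x))
        (fun T _ => hcy.intervalIntegrable _ _)
        (fun t _ => by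
          rw [intervalIntegral.integral_eq_sub_of_hasDerivAt (f := fun y => φ (x, y))
            (fun y _ => ?_) (hcy.intervalIntegrable _ _)]
          rw [derivY_eq h1]
          exact hasDerivAt_slice h1 (x, y)) one_pos
      simpa using this
  refine key.trans ?_
  rw [Cyl.norm_sq]
  have := traceConst_pos hs.1
  gcongr
  nlinarith [sq_nonneg ‖w.gx‖]

/-- Bessel's inequality for the gradients of Dirichlet eigenfunctions: these are orthogonal, with
`‖∇vᵢ‖² = λᵢ`. -/
theorem sum_eigenvalue_mul_sq_le {n : ℕ} {lam : Fin n → ℝ} {v : Fin n → L2 Ω}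
    (hv : Orthonormal ℝ v) (hev : ∀ i, IsDirichletEigenpair Ω (lam i) (v i))
    {φ : E d → ℝ} (hφ : IsTest Ω φ) {u : L2 Ω} (hu : u =ᵐ[volume.restrict Ω] φ) :
    ∑ i, lam i * ⟪v i, u⟫ ^ 2 ≤ ∫ x in Ω, ‖gradient φ x‖ ^ 2 := by
  choose p hp hpv hpr using fun i => (hev i).2
  have hG : MemLp (gradient φ) 2 (volume.restrict Ω) :=
    (continuous_gradient hφ.1).memLp_of_hasCompactSupport (hasCompactSupport_gradient hφ.2.1)
  set r : L2Pair Ω := WithLp.toLp 2 (u, hG.toLp) with hr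
  have hr2 : r.snd =ᵐ[volume.restrict Ω] gradient φ := hG.coeFn_toLp
  have hr1 : r.fst =ᵐ[volume.restrict Ω] φ := hu
  have hrH : r ∈ H10 Ω := by
    refine ⟨fun ψ hψ => ?_, subset_closure ⟨φ, hφ, hr1, hr2⟩⟩
    rw [integral_congr_ae (g := fun x => φ x • gradient ψ x)
        (by filter_upwards [hr1] with x hx; rw [hx]),
      integral_congr_ae (f := fun x => ψ x • r.snd x) (g := fun x => ψ x • gradient φ x)
        (by filter_upwards [hr2] with x hx; rw [hx])]
    exact hφ.integral_smul_gradient hψ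
  have h1 : ∀ i, ⟪(p i).snd, r.snd⟫ = lam i * ⟪v i, u⟫ := fun i => by
    rw [hpr i r hrH, hpv i]
    rfl
  have h2 : ∀ i j, ⟪(p i).snd, (p j).snd⟫ = if i = j then lam i else 0 := fun i j => by
    rw [hpr i _ (hp j), hpv i, hpv j, orthonormal_iff_ite.1 hv i j]
    split_ifs <;> simp
  rw [← norm_sq_eq_integral _ hr2]
  have h3 : 0 ≤ ‖r.snd - ∑ i, ⟪v i, u⟫ • (p i).snd‖ ^ 2 := sq_nonneg _
  rw [norm_sub_sq_real] at h3
  have h4 : ⟪r.snd, ∑ i, ⟪v i, u⟫ • (p i).snd⟫ = ∑ i, lam i * ⟪v i, u⟫ ^ 2 := by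
    rw [inner_sum]
    refine Finset.sum_congr rfl fun i _ => ?_
    rw [inner_smul_right, real_inner_comm (p i).snd r.snd, h1]; ring
  have h5 : ‖∑ i, ⟪v i, u⟫ • (p i).snd‖ ^ 2 = ∑ i, lam i * ⟪v i, u⟫ ^ 2 := by
    rw [← real_inner_self_eq_norm_sq, inner_sum]
    refine Finset.sum_congr rfl fun i _ => ?_
    rw [sum_inner, Finset.sum_eq_single i]
    · rw [inner_smul_left, inner_smul_right, h2, if_pos rfl]; simp; ring
    · intro j _ hj
      rw [inner_smul_left, inner_smul_right, h2, if_neg hj]; simp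
    · simp
  rw [h4, h5] at h3
  linarith

theorem continuous_integral_mul_slice {v : E d → ℝ} (hv : Integrable v (volume.restrict Ω))
    {F : E d × ℝ → ℝ} (hF : Continuous F) (hc : HasCompactSupport F) :
    Continuous fun y => ∫ x in Ω, v x * F (x, y) := by
  obtain ⟨M, hM⟩ := hc.exists_bound_of_continuous hF
  refine continuous_of_dominated (bound := fun x => ‖v x‖ * M) (fun y => ?_) (fun y => ?_)
    (hv.norm.mul_const M) ?_
  · exact hv.aestronglyMeasurable.mul
      (hF.comp (by fun_prop : Continuous fun x : E d => (x, y))).aestronglyMeasurable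
  · refine Filter.Eventually.of_forall fun x => ?_
    rw [norm_mul]
    gcongr
    exact hM _
  · exact Filter.Eventually.of_forall fun x =>
      continuous_const.mul (hF.comp (by fun_prop : Continuous fun y : ℝ => (x, y)))

theorem hasCompactSupport_integral_mul_slice (v : E d → ℝ) {F : E d × ℝ → ℝ}
    (hc : HasCompactSupport F) : HasCompactSupport fun y => ∫ x in Ω, v x * F (x, y) := by
  refine HasCompactSupport.intro (hc.isCompact.image continuous_snd) fun y hy => ?_
  have : ∀ x, F (x, y) = 0 := fun x => by
    by_contra h
    exact hy ⟨(x, y), subset_tsupport _ h, rfl⟩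
  simp [this]

/-- The fundamental theorem of calculus for `y ↦ ∫ v(x) φ(x, y) dx`. -/
theorem integral_mul_slice_sub {v : E d → ℝ} (hv : Integrable v (volume.restrict Ω))
    {φ : E d × ℝ → ℝ} (h1 : ContDiff ℝ ∞ φ) (h2 : HasCompactSupport φ) {t : ℝ} (ht : 0 < t) :
    (∫ x in Ω, v x * φ (x, t)) - ∫ x in Ω, v x * φ (x, 0)
      = ∫ y in (0)..t, ∫ x in Ω, v x * derivY φ (x, y) := by
  have hcd := continuous_derivY h1
  obtain ⟨M, hM⟩ := (hasCompactSupport_derivY h1 h2).exists_bound_of_continuous hcd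
  obtain ⟨N, hN⟩ := h2.exists_bound_of_continuous h1.continuous
  have hiφ : ∀ y, Integrable (fun x => v x * φ (x, y)) (volume.restrict Ω) := fun y =>
    hv.mul_bdd (c := N) (h1.continuous.comp
      (by fun_prop : Continuous fun x : E d => (x, y))).aestronglyMeasurable
      (Filter.Eventually.of_forall fun x => hN _)
  have hi : Integrable (fun z : ℝ × E d => v z.2 * derivY φ (z.2, z.1))
      ((volume.restrict (Ioc 0 t)).prod (volume.restrict Ω)) := by
    refine Integrable.mul_bdd (c := M) ?_ (hcd.comp
      (by fun_prop : Continuous fun z : ℝ × E d => (z.2, z.1))).aestronglyMeasurable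
      (Filter.Eventually.of_forall fun x => hM _)
    simpa using (integrable_const (1 : ℝ) (μ := volume.restrict (Ioc 0 t))).mul_prod hv
  rw [← integral_sub (hiφ t) (hiφ 0), intervalIntegral.integral_of_le ht.le,
    integral_integral_swap hi]
  refine integral_congr_ae (Filter.Eventually.of_forall fun x => ?_)
  show v x * φ (x, t) - v x * φ (x, 0) = ∫ y in Ioc 0 t, v x * derivY φ (x, y)
  have hcy : Continuous fun y => derivY φ (x, y) := hcd.comp (by fun_prop)
  rw [integral_const_mul, ← intervalIntegral.integral_of_le ht.le,
    intervalIntegral.integral_eq_sub_of_hasDerivAt (f := fun y => φ (x, y))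
    (fun y _ => ?_) (hcy.intervalIntegrable _ _), mul_sub]
  rw [derivY_eq h1]
  exact hasDerivAt_slice h1 (x, y)

/-- The trace on `Ω × {0}` is bounded in `ℍ^s(Ω)`, for smooth functions: the one-dimensional
inequality, with `λ = λᵢ`, applies to the coefficients of the slices `φ(·, y)`, and Bessel's
inequality bounds the sum over the eigenfunctions. -/
theorem Represents.sum_trace_le [IsFiniteMeasure (volume.restrict Ω)] (hs : s ∈ Ioo (0 : ℝ) 1)
    {φ : E d × ℝ → ℝ} (hφ : IsCylTest Ω φ)
    {w : Cyl Ω s} (hw : Represents φ w) {g : L2 Ω}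
    (hg : g =ᵐ[volume.restrict Ω] fun x => φ (x, 0)) {n : ℕ} {lam : Fin n → ℝ} {v : Fin n → L2 Ω}
    (hv : Orthonormal ℝ v) (hev : ∀ i, IsDirichletEigenpair Ω (lam i) (v i)) :
    ∑ i, lam i ^ s * ⟪v i, g⟫ ^ 2 ≤ traceConst s * ‖w‖ ^ 2 := by
  have := isFiniteMeasureOnCompacts_cyl Ω hs.2
  have := isFiniteMeasureOnCompacts_wt hs.2
  have h1 := hφ.1
  have h2 := hφ.2.1
  have hvi : ∀ i, Integrable (v i) (volume.restrict Ω) := fun i =>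
    (Lp.memLp (v i)).integrable (by norm_num)
  set a : Fin n → ℝ → ℝ := fun i y => ∫ x in Ω, v i x * φ (x, y) with ha
  set b : Fin n → ℝ → ℝ := fun i y => ∫ x in Ω, v i x * derivY φ (x, y) with hb
  have hca : ∀ i, Continuous (a i) := fun i =>
    continuous_integral_mul_slice (hvi i) h1.continuous h2
  have hcb : ∀ i, Continuous (b i) := fun i =>
    continuous_integral_mul_slice (hvi i) (continuous_derivY h1) (hasCompactSupport_derivY h1 h2)
  have hia : ∀ i, Integrable (fun y => a i y ^ 2) (wt s) := fun i => by
    simpa using integrable_norm_sq (μ := wt s) (hca i)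
      (hasCompactSupport_integral_mul_slice (v i) h2)
  have hib : ∀ i, Integrable (fun y => b i y ^ 2) (wt s) := fun i => by
    simpa using integrable_norm_sq (μ := wt s) (hcb i)
      (hasCompactSupport_integral_mul_slice (v i) (hasCompactSupport_derivY h1 h2))
  have hi1 : Integrable (fun z => ‖gradX φ z‖ ^ 2) (cyl Ω s) :=
    integrable_norm_sq (continuous_gradX h1) (hasCompactSupport_gradX h1 h2)
  have hi2 : Integrable (fun z => ‖derivY φ z‖ ^ 2) (cyl Ω s) :=
    integrable_norm_sq (continuous_derivY h1) (hasCompactSupport_derivY h1 h2)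
  have hi1' := hi1
  have hi2' := hi2
  rw [cyl_eq_prod] at hi1' hi2'
  have hC := traceConst_pos hs.1
  have hslice : ∀ i, lam i ^ s * ⟪v i, g⟫ ^ 2 ≤
      traceConst s * ∫ y, (lam i * a i y ^ 2 + b i y ^ 2) ∂(wt s) := by
    intro i
    rw [inner_eq_integral_mul _ _ hg, integral_add ((hia i).const_mul _) (hib i),
      integral_const_mul]
    rcases (hev i).nonneg.eq_or_lt with h0 | h0
    -- a zero eigenvalue would not contribute to the left-hand side, as `s > 0`
    · rw [← h0, Real.zero_rpow hs.1.ne', zero_mul, zero_mul, zero_add]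
      exact mul_nonneg hC.le (integral_nonneg fun y => sq_nonneg _)
    · exact rpow_mul_sq_le hs (g := a i) (h := b i) (hia i) (hib i)
        (fun T _ => (hcb i).intervalIntegrable _ _)
        (fun t ht => integral_mul_slice_sub (hvi i) h1 h2 ht) h0
  have hpt : ∀ y, ∑ i, (lam i * a i y ^ 2 + b i y ^ 2) ≤
      (∫ x in Ω, ‖gradX φ (x, y)‖ ^ 2) + ∫ x in Ω, ‖derivY φ (x, y)‖ ^ 2 := by
    intro y
    have hm1 : MemLp (fun x => φ (x, y)) 2 (volume.restrict Ω) :=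
      (h1.continuous.comp
        (by fun_prop : Continuous fun x : E d => (x, y))).memLp_of_hasCompactSupport
        (hasCompactSupport_slice h2 y)
    have hm2 : MemLp (fun x => derivY φ (x, y)) 2 (volume.restrict Ω) :=
      ((continuous_derivY h1).comp
        (by fun_prop : Continuous fun x : E d => (x, y))).memLp_of_hasCompactSupport
        (hasCompactSupport_slice (hasCompactSupport_derivY h1 h2) y)
    rw [Finset.sum_add_distrib]
    refine add_le_add ?_ ?_
    · have := sum_eigenvalue_mul_sq_le hv hev (hφ.isTest_slice y) hm1.coeFn_toLp
      simp only [inner_eq_integral_mul _ _ hm1.coeFn_toLp] at this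
      exact this
    · have := hv.sum_inner_products_le (s := Finset.univ) hm2.toLp
      rw [norm_sq_eq_integral _ hm2.coeFn_toLp] at this
      simp only [inner_eq_integral_mul _ _ hm2.coeFn_toLp] at this
      refine (Finset.sum_congr rfl fun i _ => ?_).trans_le this
      rw [Real.norm_eq_abs, sq_abs]
  have hiab : ∀ i, Integrable (fun y => lam i * a i y ^ 2 + b i y ^ 2) (wt s) := fun i =>
    ((hia i).const_mul _).add (hib i)
  calc ∑ i, lam i ^ s * ⟪v i, g⟫ ^ 2
      ≤ ∑ i, traceConst s * ∫ y, (lam i * a i y ^ 2 + b i y ^ 2) ∂(wt s) :=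
        Finset.sum_le_sum fun i _ => hslice i
    _ = traceConst s * ∫ y, ∑ i, (lam i * a i y ^ 2 + b i y ^ 2) ∂(wt s) := by
        rw [← Finset.mul_sum, integral_finsetSum _ fun i _ => hiab i]
    _ ≤ traceConst s * ∫ y, ((∫ x in Ω, ‖gradX φ (x, y)‖ ^ 2)
          + (∫ x in Ω, ‖derivY φ (x, y)‖ ^ 2)) ∂(wt s) := by
        refine mul_le_mul_of_nonneg_left (integral_mono
          (integrable_finsetSum _ fun i _ => hiab i)
          (hi1'.integral_prod_right.add hi2'.integral_prod_right) hpt) hC.le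
    _ = traceConst s * (‖w.gx‖ ^ 2 + ‖w.gy‖ ^ 2) := by
        rw [integral_add hi1'.integral_prod_right hi2'.integral_prod_right,
          norm_sq_eq_integral _ hw.2.1, norm_sq_eq_integral _ hw.2.2, integral_cyl hi1,
          integral_cyl hi2]
    _ ≤ _ := by
        rw [Cyl.norm_sq]
        gcongr
        nlinarith [sq_nonneg ‖w.val‖]

end Estimates

/-! ### The space `HL` as a closed subspace, and the trace operator -/

section Spaces

variable {d : ℕ} {Ω : Set (E d)} {s : ℝ}

/-- `w ↦ w.val` as a continuous linear map. -/
noncomputable def valL (Ω : Set (E d)) (s : ℝ) : Cyl Ω s →L[ℝ] Lp ℝ 2 (cyl Ω s) :=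
  WithLp.fstL 2 ℝ _ _

/-- `w ↦ w.gx` as a continuous linear map. -/
noncomputable def gxL (Ω : Set (E d)) (s : ℝ) : Cyl Ω s →L[ℝ] Lp (E d) 2 (cyl Ω s) :=
  WithLp.fstL 2 ℝ _ _ ∘L WithLp.sndL 2 ℝ _ _

/-- `w ↦ w.gy` as a continuous linear map. -/
noncomputable def gyL (Ω : Set (E d)) (s : ℝ) : Cyl Ω s →L[ℝ] Lp ℝ 2 (cyl Ω s) :=
  WithLp.sndL 2 ℝ _ _ ∘L WithLp.sndL 2 ℝ _ _

theorem cyl_eq_withDensity (Ω : Set (E d)) (s : ℝ) :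
    cyl Ω s = (volume.restrict (Ω ×ˢ Ioi (0 : ℝ))).withDensity
      fun z => ENNReal.ofReal (z.2 ^ alpha s) := by
  rw [cyl, prod_withDensity_right (measurable_weight s), Measure.prod_restrict]
  rfl

theorem integral_cyl_eq_setIntegral (hΩ : MeasurableSet Ω) {G : Type*} [NormedAddCommGroup G]
    [NormedSpace ℝ G] (F : E d × ℝ → G) :
    ∫ z, F z ∂(cyl Ω s) = ∫ z in Ω ×ˢ Ioi (0 : ℝ), z.2 ^ alpha s • F z := by
  rw [cyl_eq_withDensity, integral_withDensity_eq_integral_toReal_smul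
    (f := fun z : E d × ℝ => ENNReal.ofReal (z.2 ^ alpha s))
    ((measurable_weight s).comp measurable_snd) (by simp)]
  refine setIntegral_congr_fun (hΩ.prod measurableSet_Ioi) fun z hz => ?_
  rw [ENNReal.toReal_ofReal (Real.rpow_nonneg (le_of_lt hz.2) _)]

/-- Integration against a continuous function with compact support in the open cylinder, with
respect to the unweighted measure, is continuous on the weighted space: the weight is bounded above
and below on the support. -/
theorem exists_clm_integral_eq (hΩ : MeasurableSet Ω) (hs : s < 1) {G F H : Type*}
    [NormedAddCommGroup G] [NormedSpace ℝ G] [NormedAddCommGroup F] [NormedSpace ℝ F]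
    [NormedAddCommGroup H] [NormedSpace ℝ H] [CompleteSpace H] [SecondCountableTopology G]
    (B : G →L[ℝ] F →L[ℝ] H)
    {D : E d × ℝ → G} (hD : Continuous D) (hc : HasCompactSupport D)
    (hsup : tsupport D ⊆ Ω ×ˢ Ioi (0 : ℝ)) :
    ∃ L : Lp F 2 (cyl Ω s) →L[ℝ] H,
      ∀ u, ∫ z in Ω ×ˢ Ioi (0 : ℝ), B (D z) (u z) = L u := by
  have := isFiniteMeasureOnCompacts_cyl Ω hs
  set k : E d × ℝ → G := fun z => z.2 ^ (-alpha s) • D z with hk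
  have hksub : tsupport k ⊆ tsupport D :=
    tsupport_smul_subset_right (fun z : E d × ℝ => z.2 ^ (-alpha s)) D
  have hkc : Continuous k := by
    refine ContinuousOn.continuous_of_tsupport_subset (s := univ ×ˢ Ioi (0 : ℝ)) ?_
      (isOpen_univ.prod isOpen_Ioi) (hksub.trans (hsup.trans (prod_mono (subset_univ _) le_rfl)))
    exact (continuousOn_snd.rpow_const fun z hz => Or.inl (ne_of_gt hz.2)).smul hD.continuousOn
  have hkL : MemLp k 2 (cyl Ω s) :=
    hkc.memLp_of_hasCompactSupport (hc.of_isClosed_subset (isClosed_tsupport _) hksub)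
  refine ⟨B.lpPairing (cyl Ω s) 2 2 hkL.toLp, fun u => ?_⟩
  have hae : ∫ z, B ((hkL.toLp : Lp G 2 (cyl Ω s)) z) (u z) ∂(cyl Ω s)
      = ∫ z, B (k z) (u z) ∂(cyl Ω s) :=
    integral_congr_ae (by filter_upwards [hkL.coeFn_toLp] with z hz; rw [hz])
  rw [ContinuousLinearMap.lpPairing_eq_integral, hae, integral_cyl_eq_setIntegral hΩ]
  refine setIntegral_congr_fun (hΩ.prod measurableSet_Ioi) fun z hz => ?_
  have h0 : (0 : ℝ) < z.2 := hz.2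
  simp only [hk, map_smul, smul_apply, smul_smul]
  rw [← Real.rpow_add h0, add_neg_cancel, Real.rpow_zero, one_smul]

/-- `H¹(y^α, 𝒞)` is a closed subspace: each of its defining equations is the vanishing of a
continuous linear map. -/
theorem exists_submodule_H1w (hΩ : MeasurableSet Ω) (hs : s < 1) :
    ∃ S : Submodule ℝ (Cyl Ω s), IsClosed (S : Set (Cyl Ω s)) ∧ (S : Set (Cyl Ω s)) = H1w Ω s := by
  have key : ∀ ψ : E d × ℝ → ℝ, ContDiff ℝ ∞ ψ → HasCompactSupport ψ →
      tsupport ψ ⊆ Ω ×ˢ Ioi (0 : ℝ) → ∃ L : Cyl Ω s →L[ℝ] E d × ℝ, ∀ w, L w = 0 ↔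
      ((∫ z in Ω ×ˢ Ioi (0 : ℝ), w.val z • gradX ψ z
        = - ∫ z in Ω ×ˢ Ioi (0 : ℝ), ψ z • w.gx z) ∧
      (∫ z in Ω ×ˢ Ioi (0 : ℝ), w.val z * derivY ψ z
        = - ∫ z in Ω ×ˢ Ioi (0 : ℝ), ψ z * w.gy z)) := by
    intro ψ h1 h2 h3
    obtain ⟨L₁, hL₁⟩ := exists_clm_integral_eq hΩ hs (ContinuousLinearMap.lsmul ℝ ℝ (E := E d)).flip
      (continuous_gradX h1) (hasCompactSupport_gradX h1 h2) ((tsupport_gradX_subset h1).trans h3)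
    obtain ⟨L₂, hL₂⟩ := exists_clm_integral_eq hΩ hs (ContinuousLinearMap.lsmul ℝ ℝ (E := E d))
      h1.continuous h2 h3
    obtain ⟨L₃, hL₃⟩ := exists_clm_integral_eq hΩ hs (ContinuousLinearMap.lsmul ℝ ℝ (E := ℝ)).flip
      (continuous_derivY h1) (hasCompactSupport_derivY h1 h2)
      ((tsupport_derivY_subset h1).trans h3)
    obtain ⟨L₄, hL₄⟩ := exists_clm_integral_eq hΩ hs (ContinuousLinearMap.lsmul ℝ ℝ (E := ℝ))
      h1.continuous h2 h3
    simp only [ContinuousLinearMap.flip_apply, ContinuousLinearMap.lsmul_apply,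
      smul_eq_mul] at hL₁ hL₂ hL₃ hL₄
    refine ⟨(L₁ ∘L valL Ω s + L₂ ∘L gxL Ω s).prod (L₃ ∘L valL Ω s + L₄ ∘L gyL Ω s), fun w => ?_⟩
    rw [hL₁, hL₂, hL₃, hL₄, ← add_eq_zero_iff_eq_neg, ← add_eq_zero_iff_eq_neg]
    exact Prod.ext_iff
  choose L hL using key
  refine ⟨⨅ (ψ) (h1) (h2) (h3), LinearMap.ker (L ψ h1 h2 h3).toLinearMap, ?_, ?_⟩
  · simp only [Submodule.coe_iInf]
    exact isClosed_iInter fun ψ => isClosed_iInter fun h1 => isClosed_iInter fun h2 =>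
      isClosed_iInter fun h3 => (L ψ h1 h2 h3).isClosed_ker
  · ext w
    simp only [SetLike.mem_coe, Submodule.mem_iInf, LinearMap.mem_ker]
    exact forall_congr' fun ψ => forall_congr' fun h1 => forall_congr' fun h2 =>
      forall_congr' fun h3 => hL ψ h1 h2 h3 w

theorem IsCylTest.add {φ ψ : E d × ℝ → ℝ} (hφ : IsCylTest Ω φ) (hψ : IsCylTest Ω ψ) :
    IsCylTest Ω (φ + ψ) := by
  refine ⟨hφ.1.add hψ.1, hφ.2.1.add hψ.2.1, (closure_mono ?_).trans
    (closure_union.subset.trans (union_subset hφ.2.2 hψ.2.2))⟩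
  exact Function.support_add φ ψ

theorem IsCylTest.smul {φ : E d × ℝ → ℝ} (hφ : IsCylTest Ω φ) (c : ℝ) : IsCylTest Ω (c • φ) := by
  have h : tsupport (c • φ) ⊆ tsupport φ := tsupport_smul_subset_right (fun _ => c) φ
  exact ⟨hφ.1.const_smul c, hφ.2.1.of_isClosed_subset (isClosed_tsupport _) h, h.trans hφ.2.2⟩

theorem isCylTest_zero : IsCylTest Ω (0 : E d × ℝ → ℝ) := by
  refine ⟨contDiff_const, HasCompactSupport.zero, ?_⟩
  simp [tsupport]

theorem Represents.add {φ ψ : E d × ℝ → ℝ} (hφ : IsCylTest Ω φ) (hψ : IsCylTest Ω ψ)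
    {w u : Cyl Ω s} (hw : Represents φ w) (hu : Represents ψ u) : Represents (φ + ψ) (w + u) := by
  refine ⟨?_, ?_, ?_⟩
  · exact (Lp.coeFn_add w.val u.val).trans (hw.1.add hu.1)
  · rw [gradX_add hφ.1 hψ.1]
    exact (Lp.coeFn_add w.gx u.gx).trans (hw.2.1.add hu.2.1)
  · rw [derivY_add hφ.1 hψ.1]
    exact (Lp.coeFn_add w.gy u.gy).trans (hw.2.2.add hu.2.2)

theorem Represents.smul {φ : E d × ℝ → ℝ} (hφ : IsCylTest Ω φ) {w : Cyl Ω s}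
    (hw : Represents φ w) (c : ℝ) : Represents (c • φ) (c • w) := by
  refine ⟨?_, ?_, ?_⟩
  · exact (Lp.coeFn_smul c w.val).trans (hw.1.const_smul c)
  · rw [gradX_smul hφ.1]
    exact (Lp.coeFn_smul c w.gx).trans (hw.2.1.const_smul c)
  · rw [derivY_smul hφ.1]
    exact (Lp.coeFn_smul c w.gy).trans (hw.2.2.const_smul c)

theorem represents_zero : Represents (0 : E d × ℝ → ℝ) (0 : Cyl Ω s) := by
  refine ⟨Lp.coeFn_zero _ _ _, ?_, ?_⟩
  · rw [gradX_eq (φ := 0) contDiff_const]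
    refine (Lp.coeFn_zero _ _ _).trans (Filter.Eventually.of_forall fun z => ?_)
    simp [fderiv_zero]
  · rw [derivY_eq (φ := 0) contDiff_const]
    refine (Lp.coeFn_zero _ _ _).trans (Filter.Eventually.of_forall fun z => ?_)
    simp [fderiv_zero]

/-- The elements represented by smooth functions vanishing near the lateral boundary. -/
def testSubmodule (Ω : Set (E d)) (s : ℝ) : Submodule ℝ (Cyl Ω s) where
  carrier := {w | ∃ φ, IsCylTest Ω φ ∧ Represents φ w}
  zero_mem' := ⟨0, isCylTest_zero, represents_zero⟩
  add_mem' := by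
    rintro w u ⟨φ, hφ, hw⟩ ⟨ψ, hψ, hu⟩
    exact ⟨φ + ψ, hφ.add hψ, hw.add hφ hψ hu⟩
  smul_mem' := by
    rintro c w ⟨φ, hφ, hw⟩
    exact ⟨c • φ, hφ.smul c, hw.smul hφ c⟩

/-- The graph of the trace on smooth functions; `IsTrace` is membership in its closure. -/
def traceGraph (Ω : Set (E d)) (s : ℝ) : Submodule ℝ (Cyl Ω s × L2 Ω) where
  carrier := {r | ∃ φ, IsCylTest Ω φ ∧ Represents φ r.1 ∧
    r.2 =ᵐ[volume.restrict Ω] fun x => φ (x, 0)}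
  zero_mem' := ⟨0, isCylTest_zero, represents_zero, Lp.coeFn_zero _ _ _⟩
  add_mem' := by
    rintro w u ⟨φ, hφ, hw, hw'⟩ ⟨ψ, hψ, hu, hu'⟩
    exact ⟨φ + ψ, hφ.add hψ, hw.add hφ hψ hu, (Lp.coeFn_add w.2 u.2).trans (hw'.add hu')⟩
  smul_mem' := by
    rintro c w ⟨φ, hφ, hw, hw'⟩
    exact ⟨c • φ, hφ.smul c, hw.smul hφ c, (Lp.coeFn_smul c w.2).trans (hw'.const_smul c)⟩

theorem isTrace_iff {w : Cyl Ω s} {g : L2 Ω} :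
    IsTrace w g ↔ (w, g) ∈ (traceGraph Ω s).topologicalClosure := Iff.rfl

theorem IsTrace.norm_sq_le (hs : s ∈ Ioo (0 : ℝ) 1) {w : Cyl Ω s} {g : L2 Ω}
    (h : IsTrace w g) : ‖g‖ ^ 2 ≤ traceConst s * ‖w‖ ^ 2 := by
  have hcl : IsClosed {r : Cyl Ω s × L2 Ω | ‖r.2‖ ^ 2 ≤ traceConst s * ‖r.1‖ ^ 2} :=
    isClosed_le (continuous_snd.norm.pow 2)
      (continuous_const.mul (continuous_fst.norm.pow 2))
  have hsub : (traceGraph Ω s : Set (Cyl Ω s × L2 Ω)) ⊆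
      {r : Cyl Ω s × L2 Ω | ‖r.2‖ ^ 2 ≤ traceConst s * ‖r.1‖ ^ 2} := by
    rintro r ⟨φ, hφ, hw, hg⟩
    exact hw.trace_le hs hφ hg
  have h' := closure_minimal hsub hcl h
  rwa [mem_ofPred_eq] at h'

theorem IsTrace.hsNormSq_le [IsFiniteMeasure (volume.restrict Ω)] (hs : s ∈ Ioo (0 : ℝ) 1)
    {w : Cyl Ω s} {g : L2 Ω} (h : IsTrace w g) :
    hsNormSq Ω s g ≤ ENNReal.ofReal (traceConst s * ‖w‖ ^ 2) := by
  refine iSup_le fun n => iSup_le fun lam => iSup_le fun v => iSup_le fun hv =>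
    iSup_le fun hev => ?_
  rw [← ENNReal.ofReal_sum_of_nonneg fun i _ =>
    mul_nonneg (Real.rpow_nonneg (hev i).nonneg _) (sq_nonneg _)]
  refine ENNReal.ofReal_le_ofReal ?_
  have hcl : IsClosed {r : Cyl Ω s × L2 Ω |
      ∑ i, lam i ^ s * ⟪v i, r.2⟫ ^ 2 ≤ traceConst s * ‖r.1‖ ^ 2} :=
    isClosed_le (continuous_finsetSum _ fun i _ =>
        continuous_const.mul ((continuous_const.inner continuous_snd).pow 2))
      (continuous_const.mul (continuous_fst.norm.pow 2))
  have hsub : (traceGraph Ω s : Set (Cyl Ω s × L2 Ω)) ⊆ {r : Cyl Ω s × L2 Ω |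
      ∑ i, lam i ^ s * ⟪v i, r.2⟫ ^ 2 ≤ traceConst s * ‖r.1‖ ^ 2} := by
    rintro r ⟨φ, hφ, hw, hg⟩
    exact hw.sum_trace_le hs hφ hg hv hev
  have h' := closure_minimal hsub hcl h
  rwa [mem_ofPred_eq] at h'

theorem IsTrace.add {w u : Cyl Ω s} {g k : L2 Ω} (h : IsTrace w g) (h' : IsTrace u k) :
    IsTrace (w + u) (g + k) :=
  isTrace_iff.2 ((traceGraph Ω s).topologicalClosure.add_mem h h')

theorem IsTrace.smul {w : Cyl Ω s} {g : L2 Ω} (h : IsTrace w g) (c : ℝ) :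
    IsTrace (c • w) (c • g) :=
  isTrace_iff.2 ((traceGraph Ω s).topologicalClosure.smul_mem c h)

theorem IsTrace.unique (hs : s ∈ Ioo (0 : ℝ) 1) {w : Cyl Ω s} {g k : L2 Ω} (h : IsTrace w g)
    (h' : IsTrace w k) : g = k := by
  have h2 := (h.add (h'.smul (-1))).norm_sq_le hs
  have h3 : w + (-1 : ℝ) • w = 0 := by simp
  rw [h3, norm_zero, zero_pow two_ne_zero, mul_zero] at h2
  have h4 : ‖g + (-1 : ℝ) • k‖ = 0 := by
    have := sq_nonneg ‖g + (-1 : ℝ) • k‖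
    exact pow_eq_zero_iff two_ne_zero |>.1 (le_antisymm h2 this)
  have h5 := norm_eq_zero.1 h4
  rwa [neg_smul, one_smul, ← sub_eq_add_neg, sub_eq_zero] at h5

/-- The first projection of the closed trace graph has closed range, since it is bounded below. -/
theorem exists_isTrace (hs : s ∈ Ioo (0 : ℝ) 1) {w : Cyl Ω s} (hw : w ∈ HL Ω s) :
    ∃ g, IsTrace w g := by
  set T := (traceGraph Ω s).topologicalClosure with hT
  have : CompleteSpace T := (Submodule.isClosed_topologicalClosure _).completeSpace_coe
  let p : T →L[ℝ] Cyl Ω s := (ContinuousLinearMap.fst ℝ (Cyl Ω s) (L2 Ω)) ∘L T.subtypeL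
  have hC := traceConst_pos hs.1
  have hp : AntilipschitzWith (Real.toNNReal (traceConst s + 1)) p := by
    refine p.antilipschitz_of_bound fun r => ?_
    have h1 : IsTrace r.1.1 r.1.2 := r.2
    have h2 := h1.norm_sq_le hs
    rw [Real.coe_toNNReal _ (by positivity)]
    show ‖r.1‖ ≤ (traceConst s + 1) * ‖r.1.1‖
    rw [Prod.norm_def]
    refine max_le ?_ ?_
    · nlinarith [norm_nonneg r.1.1]
    · refine abs_le_of_sq_le_sq' ?_ (by positivity) |>.2
      refine h2.trans ?_
      rw [mul_pow]
      gcongr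
      nlinarith
  have hcl : IsClosed (range p) := hp.isClosed_range p.uniformContinuous
  have hsub : {w : Cyl Ω s | ∃ φ, IsCylTest Ω φ ∧ Represents φ w} ⊆ range p := by
    rintro u ⟨φ, hφ, hu⟩
    have hm : MemLp (fun x => φ (x, 0)) 2 (volume.restrict Ω) :=
      (hφ.1.continuous.comp (by fun_prop : Continuous fun x : E d => (x, (0 : ℝ)))
        ).memLp_of_hasCompactSupport (hasCompactSupport_slice hφ.2.1 0)
    exact ⟨⟨(u, hm.toLp), subset_closure ⟨φ, hφ, hu, hm.coeFn_toLp⟩⟩, rfl⟩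
  obtain ⟨r, rfl⟩ := closure_minimal hsub hcl hw.2
  exact ⟨r.1.2, r.2⟩

theorem isTrace_tr (hs : s ∈ Ioo (0 : ℝ) 1) {w : Cyl Ω s} (hw : w ∈ HL Ω s) :
    IsTrace w (tr w) := by
  have h := exists_isTrace hs hw
  rw [tr, dif_pos h]
  exact h.choose_spec

/-- `HL Ω s` as a subspace. The proofs `hΩ` and `hs` are arguments because they are what makes
`H1w Ω s` a subspace. -/
noncomputable def HLsub (Ω : Set (E d)) (s : ℝ) (hΩ : MeasurableSet Ω) (hs : s < 1) :
    Submodule ℝ (Cyl Ω s) :=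
  (exists_submodule_H1w hΩ hs).choose ⊓ (testSubmodule Ω s).topologicalClosure

theorem coe_HLsub (hΩ : MeasurableSet Ω) (hs : s < 1) :
    (HLsub Ω s hΩ hs : Set (Cyl Ω s)) = HL Ω s := by
  rw [HLsub, Submodule.coe_inf, (exists_submodule_H1w hΩ hs).choose_spec.2]
  rfl

theorem mem_HLsub {hΩ : MeasurableSet Ω} {hs : s < 1} {w : Cyl Ω s} :
    w ∈ HLsub Ω s hΩ hs ↔ w ∈ HL Ω s := by
  rw [← coe_HLsub hΩ hs]; rfl

theorem completeSpace_HLsub (hΩ : MeasurableSet Ω) (hs : s < 1) :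
    CompleteSpace (HLsub Ω s hΩ hs) := by
  have h : IsClosed (HLsub Ω s hΩ hs : Set (Cyl Ω s)) := by
    rw [HLsub, Submodule.coe_inf]
    exact (exists_submodule_H1w hΩ hs).choose_spec.1.inter
      (Submodule.isClosed_topologicalClosure _)
  exact h.completeSpace_coe

/-- The trace as a bounded linear operator from `HL` to `L²(Ω)`. -/
noncomputable def trL (Ω : Set (E d)) (s : ℝ) (hΩ : MeasurableSet Ω) (hs : s ∈ Ioo (0 : ℝ) 1) :
    HLsub Ω s hΩ hs.2 →L[ℝ] L2 Ω :=
  LinearMap.mkContinuous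
    { toFun := fun w => tr w.1
      map_add' := fun w u =>
        (isTrace_tr hs (mem_HLsub.1 (w + u).2)).unique hs
          ((isTrace_tr hs (mem_HLsub.1 w.2)).add (isTrace_tr hs (mem_HLsub.1 u.2)))
      map_smul' := fun c w =>
        (isTrace_tr hs (mem_HLsub.1 (c • w).2)).unique hs
          ((isTrace_tr hs (mem_HLsub.1 w.2)).smul c) } (√(traceConst s)) fun w => by
    have h := (isTrace_tr hs (mem_HLsub.1 w.2)).norm_sq_le hs
    have h' := Real.sqrt_le_sqrt h
    rwa [Real.sqrt_sq (norm_nonneg _), Real.sqrt_mul (traceConst_pos hs.1).le,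
      Real.sqrt_sq (norm_nonneg _)] at h'

theorem trL_apply (hΩ : MeasurableSet Ω) (hs : s ∈ Ioo (0 : ℝ) 1) (w : HLsub Ω s hΩ hs.2) :
    trL Ω s hΩ hs w = tr w.1 := rfl

/-- The trace maps `HL` into `ℍ^s(Ω)`, with a bound. -/
theorem hsNormSq_tr_le [IsFiniteMeasure (volume.restrict Ω)] (hs : s ∈ Ioo (0 : ℝ) 1)
    {w : Cyl Ω s} (hw : w ∈ HL Ω s) :
    hsNormSq Ω s (tr w) ≤ ENNReal.ofReal (traceConst s * ‖w‖ ^ 2) :=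
  (isTrace_tr hs hw).hsNormSq_le hs

theorem tr_mem_Hs [IsFiniteMeasure (volume.restrict Ω)] (hs : s ∈ Ioo (0 : ℝ) 1)
    {w : Cyl Ω s} (hw : w ∈ HL Ω s) : tr w ∈ Hs Ω s :=
  (hsNormSq_tr_le hs hw).trans_lt ENNReal.ofReal_lt_top

/-- For `f ∈ ℍ^{-s}(Ω)`, the functional `w ↦ ⟨f, tr w⟩` is bounded on `HL`. -/
theorem exists_clm_pairing [IsFiniteMeasure (volume.restrict Ω)] (hΩ : MeasurableSet Ω)
    (hs : s ∈ Ioo (0 : ℝ) 1) {f : Hs Ω s →ₗ[ℝ] ℝ} (hf : IsHsDual Ω s f) :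
    ∃ ℓ : HLsub Ω s hΩ hs.2 →L[ℝ] ℝ, ∀ w, ℓ w = pairing Ω s f (tr w.1) := by
  obtain ⟨C, hC⟩ := hf
  have hm : ∀ w : HLsub Ω s hΩ hs.2, trL Ω s hΩ hs w ∈ Hs Ω s := fun w =>
    tr_mem_Hs hs (mem_HLsub.1 w.2)
  refine ⟨LinearMap.mkContinuous (f ∘ₗ (trL Ω s hΩ hs).toLinearMap.codRestrict (Hs Ω s) hm)
    (|C| * √(traceConst s)) fun w => ?_, fun w => ?_⟩
  · have h0 : |f ⟨tr w.1, hm w⟩| ≤ C * √(hsNormSq Ω s (tr w.1)).toReal := hC ⟨tr w.1, hm w⟩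
    have h1 : (hsNormSq Ω s (tr w.1)).toReal ≤ traceConst s * ‖w‖ ^ 2 :=
      ENNReal.toReal_le_of_le_ofReal (mul_nonneg (traceConst_pos hs.1).le (sq_nonneg _))
        (hsNormSq_tr_le hs (mem_HLsub.1 w.2))
    have h2 := Real.sqrt_le_sqrt h1
    rw [Real.sqrt_mul (traceConst_pos hs.1).le, Real.sqrt_sq (norm_nonneg _)] at h2
    have h3 : |f ⟨tr w.1, hm w⟩| ≤ |C| * √(traceConst s) * ‖w‖ := by
      rw [mul_assoc]
      exact h0.trans ((mul_le_mul_of_nonneg_right (le_abs_self C) (Real.sqrt_nonneg _)).trans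
        (mul_le_mul_of_nonneg_left h2 (abs_nonneg C)))
    exact h3
  · rw [pairing, dif_pos (tr_mem_Hs hs (mem_HLsub.1 w.2))]
    rfl

/-- The Poincaré inequality on `HL`. -/
theorem norm_val_sq_le (hs : s < 1) {R : ℝ} (hR : ∀ x ∈ Ω, ‖x‖ ≤ R) {u : E d} (hu : ‖u‖ = 1)
    {w : Cyl Ω s} (hw : w ∈ HL Ω s) : ‖w.val‖ ^ 2 ≤ 4 * R ^ 2 * ‖w.gx‖ ^ 2 := by
  have h1 : Continuous fun w : Cyl Ω s => ‖valL Ω s w‖ ^ 2 := by fun_prop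
  have h2 : Continuous fun w : Cyl Ω s => 4 * R ^ 2 * ‖gxL Ω s w‖ ^ 2 := by fun_prop
  have hcl : IsClosed {w : Cyl Ω s | ‖valL Ω s w‖ ^ 2 ≤ 4 * R ^ 2 * ‖gxL Ω s w‖ ^ 2} :=
    isClosed_le h1 h2
  have hsub : {w : Cyl Ω s | ∃ φ, IsCylTest Ω φ ∧ Represents φ w} ⊆
      {w : Cyl Ω s | ‖valL Ω s w‖ ^ 2 ≤ 4 * R ^ 2 * ‖gxL Ω s w‖ ^ 2} := by
    rintro r ⟨φ, hφ, hr⟩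
    exact hr.poincare hs hφ hR hu
  have h' := closure_minimal hsub hcl hw.2
  rw [mem_ofPred_eq] at h'
  exact h'

end Spaces

/-! ### The bilinear form and the Lax–Milgram theorem -/

/-- The Lax–Milgram theorem on a complete subspace. -/
theorem existsUnique_of_coercive {V : Type*} [NormedAddCommGroup V] [InnerProductSpace ℝ V]
    (S : Submodule ℝ V) [CompleteSpace S] (B : V →L[ℝ] V →L[ℝ] ℝ) {c : ℝ} (hc : 0 < c)
    (hB : ∀ w ∈ S, c * ‖w‖ ^ 2 ≤ B w w) (l : S →L[ℝ] ℝ) :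
    ∃! u, u ∈ S ∧ ∀ φ (hφ : φ ∈ S), B u φ = l ⟨φ, hφ⟩ := by
  let B' : S →L[ℝ] S →L[ℝ] ℝ := B.bilinearComp S.subtypeL S.subtypeL
  have hB' : IsCoercive B' := ⟨c, hc, fun u => by
    have := hB u.1 u.2
    rw [sq, ← mul_assoc] at this
    exact this⟩
  refine ⟨(hB'.continuousLinearEquivOfBilin.symm ((InnerProductSpace.toDual ℝ S).symm l)).1,
    ⟨Subtype.property _, fun φ hφ => ?_⟩, ?_⟩
  · have h := hB'.continuousLinearEquivOfBilin_apply
      (hB'.continuousLinearEquivOfBilin.symm ((InnerProductSpace.toDual ℝ S).symm l)) ⟨φ, hφ⟩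
    rw [ContinuousLinearEquiv.apply_symm_apply, InnerProductSpace.toDual_symm_apply] at h
    exact h.symm
  · rintro u ⟨hu, h⟩
    have h1 : (InnerProductSpace.toDual ℝ S).symm l
        = hB'.continuousLinearEquivOfBilin ⟨u, hu⟩ :=
      hB'.unique_continuousLinearEquivOfBilin fun w => by
        rw [InnerProductSpace.toDual_symm_apply]
        exact (h w.1 w.2).symm
    rw [h1, ContinuousLinearEquiv.symm_apply_apply]

section Form

variable {d : ℕ} {Ω : Set (E d)} {s : ℝ}

/-- A property of `x'` alone that holds almost everywhere in `Ω` holds almost everywhere in the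
cylinder. -/
theorem ae_cyl_of_ae {p : E d → Prop} (h : ∀ᵐ x ∂(volume.restrict Ω), p x) :
    ∀ᵐ z ∂(cyl Ω s), p z.1 :=
  (Measure.quasiMeasurePreserving_fst (μ := volume.restrict Ω) (ν := wt s)).ae h

theorem exists_ae_norm_le {X G : Type*} [MeasurableSpace X] {μ : Measure X}
    [NormedAddCommGroup G] {f : X → G} (hf : MemLp f ∞ μ) : ∃ C : ℝ, ∀ᵐ x ∂μ, ‖f x‖ ≤ C := by
  have hfin : eLpNormEssSup f μ ≠ ⊤ := by
    have := hf.2.ne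
    rwa [eLpNorm_exponent_top] at this
  refine ⟨(eLpNormEssSup f μ).toReal, ?_⟩
  filter_upwards [ae_le_eLpNormEssSup (f := f) (μ := μ)] with x hx
  have := ENNReal.toReal_mono hfin hx
  rwa [toReal_enorm] at this

theorem memLp_top_comp_fst {G : Type*} [NormedAddCommGroup G] {f : E d → G}
    (hf : MemLp f ∞ (volume.restrict Ω)) : MemLp (fun z : E d × ℝ => f z.1) ∞ (cyl Ω s) := by
  obtain ⟨C, hC⟩ := exists_ae_norm_le hf
  exact memLp_top_of_bound (hf.1.comp_quasiMeasurePreserving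
    (Measure.quasiMeasurePreserving_fst (μ := volume.restrict Ω) (ν := wt s))) C (ae_cyl_of_ae hC)

theorem memLp_sum_smul_const {X F ι κ : Type*} [Fintype ι] [Fintype κ] [MeasurableSpace X]
    {μ : Measure X} [NormedAddCommGroup F] [NormedSpace ℝ F] {p : ℝ≥0∞} {a : ι → κ → X → ℝ}
    (ha : ∀ i j, MemLp (a i j) p μ) (v : ι → κ → F) :
    MemLp (fun x => ∑ i, ∑ j, a i j x • v i j) p μ :=
  memLp_finsetSum _ fun i _ => memLp_finsetSum _ fun j _ =>
    (ContinuousLinearMap.toSpanSingleton ℝ (v i j)).comp_memLp' (ha i j)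

theorem IsDiffusionMatrix.memLp_toEuclideanCLM {A : E d → Matrix (Fin d) (Fin d) ℝ}
    (hA : IsDiffusionMatrix Ω A) :
    MemLp (fun x => Matrix.toEuclideanCLM (n := Fin d) (𝕜 := ℝ) (A x)) ∞
      (volume.restrict Ω) := by
  have h : (fun x => Matrix.toEuclideanCLM (n := Fin d) (𝕜 := ℝ) (A x)) = fun x =>
      ∑ i, ∑ j, A x i j •
        (Matrix.toEuclideanCLM (n := Fin d) (𝕜 := ℝ) (Matrix.single i j 1)) := by
    funext x
    conv_lhs => rw [Matrix.matrix_eq_sum_single (A x)]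
    simp only [map_sum]
    refine Finset.sum_congr rfl fun i _ => Finset.sum_congr rfl fun j _ => ?_
    rw [← map_smul, Matrix.smul_single, smul_eq_mul, mul_one]
  have hm := memLp_sum_smul_const hA.bounded
    fun i j => Matrix.toEuclideanCLM (n := Fin d) (𝕜 := ℝ) (Matrix.single i j 1)
  rw [h]
  exact hm

/-- Pointwise multiplication by a bounded coefficient is a bounded operator. -/
theorem exists_clm_mul {X G F : Type*} [MeasurableSpace X] {μ : Measure X} [NormedAddCommGroup G]
    [NormedSpace ℝ G] [NormedAddCommGroup F] [NormedSpace ℝ F] (B : G →L[ℝ] F →L[ℝ] F)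
    {T : X → G} (hT : MemLp T ∞ μ) :
    ∃ L : Lp F 2 μ →L[ℝ] Lp F 2 μ, ∀ u, L u =ᵐ[μ] fun x => B (T x) (u x) := by
  refine ⟨B.holderL μ ∞ 2 2 hT.toLp, fun u => ?_⟩
  refine (B.coeFn_holder (r := 2) hT.toLp u).trans ?_
  filter_upwards [hT.coeFn_toLp] with x hx
  rw [hx]

/-- The inner product as a continuous bilinear map; unlike `innerSL` it is linear, not merely
semilinear for the (trivial) conjugation, in the first argument. -/
noncomputable def innerL (V : Type*) [NormedAddCommGroup V] [InnerProductSpace ℝ V] :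
    V →L[ℝ] V →L[ℝ] ℝ :=
  (isBoundedBilinearMap_inner (𝕜 := ℝ) (E := V)).toContinuousLinearMap

theorem innerL_apply {V : Type*} [NormedAddCommGroup V] [InnerProductSpace ℝ V] (v w : V) :
    innerL V v w = ⟪v, w⟫ := rfl

/-- The zeroth-order part `∫_𝒞 y^α h w φ` of the bilinear form. -/
noncomputable def mulForm (h : E d → ℝ) (w φ : Cyl Ω s) : ℝ :=
  ∫ z, h z.1 * w.val z * φ.val z ∂(cyl Ω s)

theorem integrable_mulForm {h : E d → ℝ} (hh : MemLp h ∞ (volume.restrict Ω)) (w φ : Cyl Ω s) :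
    Integrable (fun z => h z.1 * w.val z * φ.val z) (cyl Ω s) := by
  obtain ⟨M, hM⟩ := exists_clm_mul (μ := cyl Ω s) (ContinuousLinearMap.mul ℝ ℝ)
    (memLp_top_comp_fst hh)
  refine (L2.integrable_inner (𝕜 := ℝ) (M w.val) φ.val).congr ?_
  filter_upwards [hM w.val] with z hz
  rw [hz, real_inner_comm]
  rfl

theorem exists_clm_mulForm {h : E d → ℝ} (hh : MemLp h ∞ (volume.restrict Ω)) :
    ∃ B : Cyl Ω s →L[ℝ] Cyl Ω s →L[ℝ] ℝ, ∀ w φ, B w φ = mulForm h w φ := by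
  obtain ⟨M, hM⟩ := exists_clm_mul (μ := cyl Ω s) (ContinuousLinearMap.mul ℝ ℝ)
    (memLp_top_comp_fst hh)
  refine ⟨(innerL _).bilinearComp (M ∘L valL Ω s) (valL Ω s), fun w φ => ?_⟩
  have : (innerL _).bilinearComp (M ∘L valL Ω s) (valL Ω s) w φ = ⟪M w.val, φ.val⟫ := rfl
  rw [this, L2.inner_def, mulForm]
  refine integral_congr_ae ?_
  filter_upwards [hM w.val] with z hz
  rw [hz, real_inner_comm]
  rfl

/-- The form as a continuous bilinear map, together with the operator `T` of multiplication by `A`,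
which splits it into its second-order and zeroth-order parts. -/
theorem exists_clm_form {A : E d → Matrix (Fin d) (Fin d) ℝ} (hA : IsDiffusionMatrix Ω A)
    {q : E d → ℝ} (hq : MemLp q ∞ (volume.restrict Ω)) :
    ∃ B : Cyl Ω s →L[ℝ] Cyl Ω s →L[ℝ] ℝ, ∃ T : Lp (E d) 2 (cyl Ω s) →L[ℝ] Lp (E d) 2 (cyl Ω s),
      (∀ u, T u =ᵐ[cyl Ω s] fun z => (A z.1).toEuclideanLin (u z)) ∧
      (∀ w φ, B w φ = ⟪T w.gx, φ.gx⟫ + ⟪w.gy, φ.gy⟫ + mulForm q w φ) ∧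
      ∀ w φ, B w φ = form A q w φ := by
  obtain ⟨T, hT⟩ := exists_clm_mul (μ := cyl Ω s) (ContinuousLinearMap.id ℝ (E d →L[ℝ] E d))
    (memLp_top_comp_fst hA.memLp_toEuclideanCLM)
  obtain ⟨M, hM⟩ := exists_clm_mulForm (s := s) hq
  have hB : ∀ w φ, ((innerL _).bilinearComp (T ∘L gxL Ω s) (gxL Ω s)
      + (innerL _).bilinearComp (gyL Ω s) (gyL Ω s) + M) w φ
      = ⟪T w.gx, φ.gx⟫ + ⟪w.gy, φ.gy⟫ + mulForm q w φ := fun w φ => by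
    rw [← hM]; rfl
  refine ⟨_, T, hT, hB, fun w φ => ?_⟩
  have hi : Integrable (fun z => ⟪T w.gx z, φ.gx z⟫ + ⟪w.gy z, φ.gy z⟫) (cyl Ω s) :=
    (L2.integrable_inner _ _).add (L2.integrable_inner _ _)
  rw [hB, L2.inner_def, L2.inner_def, mulForm, form,
    ← integral_add (L2.integrable_inner _ _) (L2.integrable_inner _ _),
    ← integral_add hi (integrable_mulForm hq w φ)]
  refine integral_congr_ae ?_
  filter_upwards [hT w.gx] with z hz
  rw [hz, real_inner_comm (φ.gy z)]
  rfl

theorem admissible.memLp {qbar : ℝ} {q : E d → ℝ} (hq : q ∈ admissible Ω qbar) :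
    MemLp q ∞ (volume.restrict Ω) := by
  refine memLp_top_of_bound hq.1 qbar ?_
  filter_upwards [hq.2] with x hx
  rw [Real.norm_eq_abs, abs_of_nonneg hx.1]
  exact hx.2

/-- The form is coercive on `HL`, uniformly in the admissible coefficients. -/
theorem exists_coercive {A : E d → Matrix (Fin d) (Fin d) ℝ} (hA : IsDiffusionMatrix Ω A)
    (hs : s < 1) {R : ℝ} (hR : ∀ x ∈ Ω, ‖x‖ ≤ R) {u : E d} (hu : ‖u‖ = 1) (qbar : ℝ) :
    ∃ c > 0, ∀ q ∈ admissible Ω qbar, ∀ w : Cyl Ω s, w ∈ HL Ω s →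
      c * ‖w‖ ^ 2 ≤ form A q w w := by
  obtain ⟨c₀, hc₀, hell⟩ := hA.elliptic
  refine ⟨min c₀ 1 / (4 * R ^ 2 + 1), by positivity, fun q hq w hw => ?_⟩
  obtain ⟨B, T, hT, hB, hBf⟩ := exists_clm_form (s := s) hA (admissible.memLp hq)
  rw [← hBf, hB]
  have h1 : c₀ * ‖w.gx‖ ^ 2 ≤ ⟪T w.gx, w.gx⟫ := by
    rw [← real_inner_self_eq_norm_sq, L2.inner_def, L2.inner_def, ← integral_const_mul]
    refine integral_mono_ae ((L2.integrable_inner _ _).const_mul _) (L2.integrable_inner _ _) ?_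
    filter_upwards [hT w.gx, ae_cyl_of_ae hell] with z hz hz'
    rw [hz, real_inner_self_eq_norm_sq]
    exact hz' _
  have h2 : 0 ≤ mulForm q w w := by
    refine integral_nonneg_of_ae ?_
    filter_upwards [ae_cyl_of_ae hq.2] with z hz
    have := mul_nonneg hz.1 (mul_self_nonneg (w.val z))
    rwa [← mul_assoc] at this
  have h3 := norm_val_sq_le hs hR hu hw
  rw [real_inner_self_eq_norm_sq, Cyl.norm_sq, div_mul_eq_mul_div, div_le_iff₀ (by positivity)]
  have hm : 0 < min c₀ 1 := by positivity
  have h4 : min c₀ 1 * ‖w.gx‖ ^ 2 ≤ c₀ * ‖w.gx‖ ^ 2 := by gcongr; exact min_le_left _ _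
  have h5 : min c₀ 1 * ‖w.gy‖ ^ 2 ≤ 1 * ‖w.gy‖ ^ 2 := by gcongr; exact min_le_right _ _
  have h6 : min c₀ 1 * (‖w.gx‖ ^ 2 + ‖w.gy‖ ^ 2)
      ≤ ⟪T w.gx, w.gx⟫ + ‖w.gy‖ ^ 2 + mulForm q w w := by linarith
  calc min c₀ 1 * (‖w.val‖ ^ 2 + ‖w.gx‖ ^ 2 + ‖w.gy‖ ^ 2)
      ≤ min c₀ 1 * (4 * R ^ 2 * ‖w.gx‖ ^ 2 + ‖w.gx‖ ^ 2 + ‖w.gy‖ ^ 2) := by gcongr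
    _ ≤ min c₀ 1 * ((‖w.gx‖ ^ 2 + ‖w.gy‖ ^ 2) * (4 * R ^ 2 + 1)) := by
        gcongr
        nlinarith [mul_nonneg (sq_nonneg R) (sq_nonneg ‖w.gy‖)]
    _ = min c₀ 1 * (‖w.gx‖ ^ 2 + ‖w.gy‖ ^ 2) * (4 * R ^ 2 + 1) := by ring
    _ ≤ _ := by gcongr

theorem form_eq_add_mulForm {A : E d → Matrix (Fin d) (Fin d) ℝ} (hA : IsDiffusionMatrix Ω A)
    {q h : E d → ℝ} (hq : MemLp q ∞ (volume.restrict Ω)) (hh : MemLp h ∞ (volume.restrict Ω))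
    (w φ : Cyl Ω s) : form A (q + h) w φ = form A q w φ + mulForm h w φ := by
  obtain ⟨B, T, hT, hB, hBf⟩ := exists_clm_form (s := s) hA hq
  have hi : Integrable (fun z => ⟪(A z.1).toEuclideanLin (w.gx z), φ.gx z⟫ + w.gy z * φ.gy z
      + q z.1 * w.val z * φ.val z) (cyl Ω s) := by
    refine Integrable.add (Integrable.add ?_ ?_) (integrable_mulForm hq w φ)
    · refine (L2.integrable_inner (𝕜 := ℝ) (T w.gx) φ.gx).congr ?_
      filter_upwards [hT w.gx] with z hz
      rw [hz]
    · refine (L2.integrable_inner (𝕜 := ℝ) w.gy φ.gy).congr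
        (Filter.Eventually.of_forall fun z => ?_)
      exact real_inner_comm (φ.gy z) (w.gy z)
  rw [form, form, mulForm, ← integral_add hi (integrable_mulForm hh w φ)]
  refine integral_congr_ae (Filter.Eventually.of_forall fun z => ?_)
  simp only [Pi.add_apply]
  ring

/-- The state problem is uniquely solvable. -/
theorem existsUnique_isState [IsFiniteMeasure (volume.restrict Ω)] (hΩ : MeasurableSet Ω)
    {A : E d → Matrix (Fin d) (Fin d) ℝ} (hA : IsDiffusionMatrix Ω A)
    (hs : s ∈ Ioo (0 : ℝ) 1) {q : E d → ℝ} (hq : MemLp q ∞ (volume.restrict Ω)) {c : ℝ}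
    (hc : 0 < c) (hcq : ∀ w : Cyl Ω s, w ∈ HL Ω s → c * ‖w‖ ^ 2 ≤ form A q w w)
    {f : Hs Ω s →ₗ[ℝ] ℝ} (hf : IsHsDual Ω s f) : ∃! u, IsState A f q u := by
  have := completeSpace_HLsub hΩ hs.2
  obtain ⟨B, T, -, -, hBf⟩ := exists_clm_form (s := s) hA hq
  obtain ⟨l, hl⟩ := exists_clm_pairing hΩ hs hf
  have h := existsUnique_of_coercive (HLsub Ω s hΩ hs.2) B hc
    (fun w hw => by rw [hBf]; exact hcq w (mem_HLsub.1 hw)) (ds s • l)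
  refine (existsUnique_congr fun u => ?_).1 h
  simp only [mem_HLsub, hBf, smul_apply, hl, smul_eq_mul, IsState]

/-- The adjoint problem is uniquely solvable. -/
theorem existsUnique_isAdjoint (hΩ : MeasurableSet Ω)
    {A : E d → Matrix (Fin d) (Fin d) ℝ} (hA : IsDiffusionMatrix Ω A)
    (hs : s ∈ Ioo (0 : ℝ) 1) {q : E d → ℝ} (hq : MemLp q ∞ (volume.restrict Ω)) {c : ℝ}
    (hc : 0 < c) (hcq : ∀ w : Cyl Ω s, w ∈ HL Ω s → c * ‖w‖ ^ 2 ≤ form A q w w)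
    (f : Hs Ω s →ₗ[ℝ] ℝ) (z : L2 Ω) : ∃! P, IsAdjoint A f z q P := by
  have := completeSpace_HLsub hΩ hs.2
  obtain ⟨B, T, -, -, hBf⟩ := exists_clm_form (s := s) hA hq
  have h := existsUnique_of_coercive (HLsub Ω s hΩ hs.2) B.flip hc
    (fun w hw => by rw [ContinuousLinearMap.flip_apply, hBf]; exact hcq w (mem_HLsub.1 hw))
    (ds s • (innerL (L2 Ω) (tr (state A f q) - z)) ∘L trL Ω s hΩ hs)
  refine (existsUnique_congr fun u => ?_).1 h
  simp only [mem_HLsub, hBf, ContinuousLinearMap.flip_apply, smul_apply,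
    ContinuousLinearMap.comp_apply, trL_apply, innerL_apply, smul_eq_mul, IsAdjoint]

end Form

/-! ### The gradient `𝔭(q)` -/

theorem ds_pos {s : ℝ} (hs : s ∈ Ioo (0 : ℝ) 1) : 0 < ds s := by
  unfold ds
  have h1 := Real.Gamma_pos_of_pos hs.1
  have h2 := Real.Gamma_pos_of_pos (sub_pos.2 hs.2)
  positivity

theorem sq_integral_mul_le {X : Type*} [MeasurableSpace X] {μ : Measure X} {a b : X → ℝ}
    (ha : MemLp a 2 μ) (hb : MemLp b 2 μ) :
    (∫ x, a x * b x ∂μ) ^ 2 ≤ (∫ x, a x ^ 2 ∂μ) * ∫ x, b x ^ 2 ∂μ := by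
  have h1 := norm_sq_eq_integral ha.toLp ha.coeFn_toLp
  have h2 := norm_sq_eq_integral hb.toLp hb.coeFn_toLp
  simp only [Real.norm_eq_abs, sq_abs] at h1 h2
  have h3 : ⟪ha.toLp, hb.toLp⟫ = ∫ x, a x * b x ∂μ := by
    rw [inner_eq_integral_mul _ _ hb.coeFn_toLp]
    refine integral_congr_ae ?_
    filter_upwards [ha.coeFn_toLp] with x hx
    rw [hx]
  rw [← h1, ← h2, ← h3, ← mul_pow, ← sq_abs]
  exact pow_le_pow_left₀ (abs_nonneg _) (abs_real_inner_le_norm _ _) 2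

section Gradient

variable {d : ℕ} {Ω : Set (E d)} {s : ℝ}

theorem integrable_sq_prod (u : Lp ℝ 2 (cyl Ω s)) :
    Integrable (fun z => u z ^ 2) ((volume.restrict Ω).prod (wt s)) :=
  (memLp_two_iff_integrable_sq (Lp.memLp u).1).1 (Lp.memLp u)

theorem ae_memLp_section (u : Lp ℝ 2 (cyl Ω s)) :
    ∀ᵐ x ∂(volume.restrict Ω), MemLp (fun y => u (x, y)) 2 (wt s) := by
  have h : AEStronglyMeasurable u ((volume.restrict Ω).prod (wt s)) := (Lp.memLp u).1
  filter_upwards [h.prodMk_left, (integrable_sq_prod u).prod_right_ae] with x hx hx'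
  exact (memLp_two_iff_integrable_sq hx).2 hx'

theorem eFun_eq (A : E d → Matrix (Fin d) (Fin d) ℝ) (f : Hs Ω s →ₗ[ℝ] ℝ) (q : E d → ℝ)
    (x : E d) : eFun A f q x = ∫ y, (state A f q).val (x, y) ^ 2 ∂(wt s) := by
  rw [eFun, integral_wt]

theorem pFun_eq (A : E d → Matrix (Fin d) (Fin d) ℝ) (f : Hs Ω s →ₗ[ℝ] ℝ) (z : L2 Ω)
    (q : E d → ℝ) (x : E d) : pFun A f z q x = -(1 / ds s) *
      ∫ y, (state A f q).val (x, y) * (adjointState A f z q).val (x, y) ∂(wt s) := by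
  rw [pFun, integral_wt]
  simp only [mul_assoc]

/-- If `∫ y^α E(q)² dy` is bounded, then `𝔭(q) ∈ L²(Ω)`, by the Cauchy–Schwarz inequality on the
vertical lines. -/
theorem memLp_pFun {A : E d → Matrix (Fin d) (Fin d) ℝ} {f : Hs Ω s →ₗ[ℝ] ℝ} {z : L2 Ω}
    {q : E d → ℝ} (he : MemLp (eFun A f q) ∞ (volume.restrict Ω)) :
    MemLp (pFun A f z q) 2 (volume.restrict Ω) := by
  set u := (state A f q).val with hu
  set p := (adjointState A f z q).val with hp
  have hum : AEStronglyMeasurable u ((volume.restrict Ω).prod (wt s)) := (Lp.memLp u).1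
  have hpm : AEStronglyMeasurable p ((volume.restrict Ω).prod (wt s)) := (Lp.memLp p).1
  have hpf : pFun A f z q = fun x => -(1 / ds s) * ∫ y, u (x, y) * p (x, y) ∂(wt s) :=
    funext fun x => pFun_eq A f z q x
  have hm : AEStronglyMeasurable (pFun A f z q) (volume.restrict Ω) := by
    rw [hpf]
    exact (hum.mul hpm).integral_prod_right'.const_mul _
  obtain ⟨C, hC⟩ := exists_ae_norm_le he
  have hk : Integrable (fun x => ∫ y, p (x, y) ^ 2 ∂(wt s)) (volume.restrict Ω) :=
    (integrable_sq_prod p).integral_prod_left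
  rw [memLp_two_iff_integrable_sq hm]
  refine Integrable.mono' (hk.const_mul ((1 / ds s) ^ 2 * C)) (hm.pow 2) ?_
  filter_upwards [hC, ae_memLp_section u, ae_memLp_section p] with x hx h1 h2
  have h3 := sq_integral_mul_le h1 h2
  rw [eFun_eq, Real.norm_eq_abs] at hx
  have h4 : 0 ≤ ∫ y, p (x, y) ^ 2 ∂(wt s) := integral_nonneg fun y => sq_nonneg _
  rw [Real.norm_eq_abs, abs_of_nonneg (sq_nonneg _), hpf]
  calc (-(1 / ds s) * ∫ y, u (x, y) * p (x, y) ∂(wt s)) ^ 2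
      = (1 / ds s) ^ 2 * (∫ y, u (x, y) * p (x, y) ∂(wt s)) ^ 2 := by ring
    _ ≤ (1 / ds s) ^ 2 * (C * ∫ y, p (x, y) ^ 2 ∂(wt s)) := by
        gcongr
        exact h3.trans (mul_le_mul_of_nonneg_right ((le_abs_self _).trans hx) h4)
    _ = _ := by ring

/-- By Fubini's theorem the derivative of the data misfit, an integral over the cylinder, is the
inner product with `𝔭(q)` in `L²(Ω)`. -/
theorem integral_pFun_mul {A : E d → Matrix (Fin d) (Fin d) ℝ} {f : Hs Ω s →ₗ[ℝ] ℝ} {z : L2 Ω}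
    {q h : E d → ℝ} (hh : MemLp h ∞ (volume.restrict Ω)) :
    ∫ x in Ω, pFun A f z q x * h x
      = -(1 / ds s) * mulForm h (state A f q) (adjointState A f z q) := by
  rw [mulForm, integral_cyl' (integrable_mulForm hh _ _), ← integral_const_mul]
  refine integral_congr_ae (Filter.Eventually.of_forall fun x => ?_)
  simp only [pFun_eq, mul_assoc]
  rw [integral_const_mul]
  ring

end Gradient

/-! ### The optimality condition -/

theorem nonneg_of_forall_quadratic {D K : ℝ} (h : ∀ t ∈ Ioc (0 : ℝ) 1, 0 ≤ t * D + K * t ^ 2) :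
    0 ≤ D := by
  by_contra! hD
  have hK : 0 < |K| + 1 := by positivity
  set t := min 1 (-D / (2 * (|K| + 1))) with ht
  have ht0 : 0 < t := lt_min one_pos (div_pos (by linarith) (by positivity))
  have h1 := h t ⟨ht0, min_le_left _ _⟩
  have h2 : t * (2 * (|K| + 1)) ≤ -D := (le_div_iff₀ (by positivity)).1 (min_le_right _ _)
  have h3 : 0 ≤ D + K * t := by
    have : t * D + K * t ^ 2 = t * (D + K * t) := by ring
    rw [this] at h1
    exact nonneg_of_mul_nonneg_right h1 ht0
  nlinarith [le_abs_self K]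

section Optimality

variable {d : ℕ} {Ω : Set (E d)} {s : ℝ}

theorem mulForm_smul (t : ℝ) (h : E d → ℝ) (w φ : Cyl Ω s) :
    mulForm (t • h) w φ = t * mulForm h w φ := by
  rw [mulForm, mulForm, ← integral_const_mul]
  simp only [Pi.smul_apply, smul_eq_mul, mul_assoc]

theorem isState_state {A : E d → Matrix (Fin d) (Fin d) ℝ} {f : Hs Ω s →ₗ[ℝ] ℝ} {q : E d → ℝ}
    (h : ∃! u, IsState A f q u) : IsState A f q (state A f q) := by
  rw [state, dif_pos h.exists]
  exact h.exists.choose_spec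

theorem isAdjoint_adjointState {A : E d → Matrix (Fin d) (Fin d) ℝ} {f : Hs Ω s →ₗ[ℝ] ℝ}
    {z : L2 Ω} {q : E d → ℝ} (h : ∃! P, IsAdjoint A f z q P) :
    IsAdjoint A f z q (adjointState A f z q) := by
  rw [adjointState, dif_pos h.exists]
  exact h.exists.choose_spec

theorem le_div_of_mul_sq_le {c b x : ℝ} (hc : 0 < c) (hb : 0 ≤ b) (hx : 0 ≤ x)
    (h : c * x ^ 2 ≤ b * x) : x ≤ b / c := by
  rcases hx.eq_or_lt with h0 | h0
  · rw [← h0]; positivity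
  · rw [le_div_iff₀ hc]
    nlinarith

/-- Segments between admissible coefficients. -/
theorem admissible.add_smul_mem {qbar : ℝ} {q₀ q : E d → ℝ} (h₀ : q₀ ∈ admissible Ω qbar)
    (h : q ∈ admissible Ω qbar) {t : ℝ} (ht : t ∈ Ioc (0 : ℝ) 1) :
    q₀ + t • (q - q₀) ∈ admissible Ω qbar := by
  refine ⟨h₀.1.add ((h.1.sub h₀.1).const_smul t), ?_⟩
  filter_upwards [h₀.2, h.2] with x hx₀ hx
  simp only [Pi.add_apply, Pi.smul_apply, Pi.sub_apply, smul_eq_mul]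
  constructor <;> nlinarith [ht.1, ht.2, hx₀.1, hx₀.2, hx.1, hx.2]

theorem sub_mem_HL (hΩ : MeasurableSet Ω) (hs : s < 1) {w u : Cyl Ω s} (hw : w ∈ HL Ω s)
    (hu : u ∈ HL Ω s) : w - u ∈ HL Ω s :=
  mem_HLsub.1 ((HLsub Ω s hΩ hs).sub_mem (mem_HLsub.2 hw) (mem_HLsub.2 hu))

theorem tr_sub (hΩ : MeasurableSet Ω) (hs : s ∈ Ioo (0 : ℝ) 1) {w u : Cyl Ω s}
    (hw : w ∈ HL Ω s) (hu : u ∈ HL Ω s) : tr (w - u) = tr w - tr u :=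
  (trL Ω s hΩ hs).map_sub ⟨w, mem_HLsub.2 hw⟩ ⟨u, mem_HLsub.2 hu⟩

/-- The states are bounded uniformly in the admissible coefficients. -/
theorem exists_norm_state_le [IsFiniteMeasure (volume.restrict Ω)] (hΩ : MeasurableSet Ω)
    {A : E d → Matrix (Fin d) (Fin d) ℝ} (hs : s ∈ Ioo (0 : ℝ) 1) {Q : Set (E d → ℝ)} {c : ℝ}
    (hc : 0 < c) (hcoer : ∀ q ∈ Q, ∀ w : Cyl Ω s, w ∈ HL Ω s → c * ‖w‖ ^ 2 ≤ form A q w w)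
    {f : Hs Ω s →ₗ[ℝ] ℝ} (hf : IsHsDual Ω s f) :
    ∃ K : ℝ, 0 ≤ K ∧ ∀ q ∈ Q, ∀ u, IsState A f q u → ‖u‖ ≤ K := by
  obtain ⟨l, hl⟩ := exists_clm_pairing hΩ hs hf
  have hds := (ds_pos hs).le
  refine ⟨ds s * ‖l‖ / c, by positivity, fun q hq u hu => ?_⟩
  have h1 := hcoer q hq u hu.1
  rw [hu.2 u hu.1, ← hl ⟨u, mem_HLsub.2 hu.1⟩] at h1
  have h2 : l ⟨u, mem_HLsub.2 hu.1⟩ ≤ ‖l‖ * ‖u‖ := (le_abs_self _).trans (l.le_opNorm _)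
  have h3 := h1.trans (mul_le_mul_of_nonneg_left h2 hds)
  rw [← mul_assoc] at h3
  exact le_div_of_mul_sq_le hc (by positivity) (norm_nonneg u) h3

/-- The equation satisfied by the difference of two states. -/
theorem form_state_sub {A : E d → Matrix (Fin d) (Fin d) ℝ} (hA : IsDiffusionMatrix Ω A)
    {f : Hs Ω s →ₗ[ℝ] ℝ} {q h : E d → ℝ} (hq : MemLp q ∞ (volume.restrict Ω))
    (hh : MemLp h ∞ (volume.restrict Ω)) {t : ℝ} {u₀ u : Cyl Ω s} (hu₀ : IsState A f q u₀)
    (hu : IsState A f (q + t • h) u) {φ : Cyl Ω s} (hφ : φ ∈ HL Ω s) :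
    form A q (u - u₀) φ = -(t * mulForm h u φ) := by
  obtain ⟨B, -, -, -, hB⟩ := exists_clm_form (s := s) hA hq
  have h1 := hu.2 φ hφ
  rw [form_eq_add_mulForm hA hq (hh.const_smul t), mulForm_smul, ← hu₀.2 φ hφ, ← hB, ← hB] at h1
  rw [← hB, map_sub, sub_apply]
  linarith

/-- The states depend on the coefficient in a Lipschitz way along segments. -/
theorem exists_norm_state_sub_le {A : E d → Matrix (Fin d) (Fin d) ℝ}
    (hA : IsDiffusionMatrix Ω A) (hΩ : MeasurableSet Ω) (hs : s < 1) {f : Hs Ω s →ₗ[ℝ] ℝ}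
    {q h : E d → ℝ} (hq : MemLp q ∞ (volume.restrict Ω)) (hh : MemLp h ∞ (volume.restrict Ω))
    {c : ℝ} (hc : 0 < c) (hcoer : ∀ w : Cyl Ω s, w ∈ HL Ω s → c * ‖w‖ ^ 2 ≤ form A q w w)
    {K : ℝ} (hK : 0 ≤ K) {u₀ : Cyl Ω s} (hu₀ : IsState A f q u₀) :
    ∃ K' : ℝ, 0 ≤ K' ∧ ∀ (t : ℝ) (u : Cyl Ω s), 0 ≤ t → IsState A f (q + t • h) u → ‖u‖ ≤ K →
      ‖u - u₀‖ ≤ K' * t := by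
  obtain ⟨M, hM⟩ := exists_clm_mulForm (s := s) hh
  refine ⟨‖M‖ * K / c, by positivity, fun t u ht hu huK => ?_⟩
  have hδ := sub_mem_HL hΩ hs hu.1 hu₀.1
  have h1 := hcoer _ hδ
  rw [form_state_sub hA hq hh hu₀ hu hδ, ← hM] at h1
  have h2 : -(M u (u - u₀)) ≤ ‖M‖ * K * ‖u - u₀‖ :=
    (neg_le_abs _).trans ((M.le_opNorm₂ u (u - u₀)).trans (by gcongr))
  have h3 : c * ‖u - u₀‖ ^ 2 ≤ ‖M‖ * K * t * ‖u - u₀‖ := by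
    have := mul_le_mul_of_nonneg_left h2 ht
    linarith
  rw [div_mul_eq_mul_div]
  exact le_div_of_mul_sq_le hc (by positivity) (norm_nonneg _) h3

/-- The adjoint state eliminates the derivative of the state from the derivative of the data
misfit, up to terms of second order. -/
theorem exists_inner_tr_sub_le {A : E d → Matrix (Fin d) (Fin d) ℝ}
    (hA : IsDiffusionMatrix Ω A) (hΩ : MeasurableSet Ω) (hs : s ∈ Ioo (0 : ℝ) 1)
    {f : Hs Ω s →ₗ[ℝ] ℝ} {z : L2 Ω}
    {q h : E d → ℝ} (hq : MemLp q ∞ (volume.restrict Ω)) (hh : MemLp h ∞ (volume.restrict Ω))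
    (hS : IsState A f q (state A f q)) {P : Cyl Ω s} (hP : IsAdjoint A f z q P) {K' : ℝ} :
    ∃ K : ℝ, ∀ (t : ℝ) (u : Cyl Ω s), 0 ≤ t → IsState A f (q + t • h) u →
      ‖u - state A f q‖ ≤ K' * t →
      ⟪tr (state A f q) - z, tr (u - state A f q)⟫
        ≤ t * (-(1 / ds s) * mulForm h (state A f q) P) + K * t ^ 2 := by
  obtain ⟨M, hM⟩ := exists_clm_mulForm (s := s) hh
  have hds := ds_pos hs
  refine ⟨1 / ds s * (‖M‖ * K' * ‖P‖), fun t u ht hu hle => ?_⟩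
  have h1 := hP.2 _ (sub_mem_HL hΩ hs.2 hu.1 hS.1)
  rw [form_state_sub hA hq hh hS hu hP.1, ← hM] at h1
  have h2 : M u P = M (state A f q) P + M (u - state A f q) P := by
    rw [map_sub, sub_apply]; ring
  have h3 : -(M (u - state A f q) P) ≤ ‖M‖ * K' * ‖P‖ * t := by
    refine (neg_le_abs _).trans ((M.le_opNorm₂ _ P).trans ?_)
    calc ‖M‖ * ‖u - state A f q‖ * ‖P‖ ≤ ‖M‖ * (K' * t) * ‖P‖ := by gcongr
      _ = _ := by ring
  have h4 : ⟪tr (state A f q) - z, tr (u - state A f q)⟫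
      = 1 / ds s * -(t * M u P) := by
    rw [h1]; field_simp
  rw [h4, h2, ← hM]
  have h5 := mul_le_mul_of_nonneg_left (mul_le_mul_of_nonneg_left h3 ht) (one_div_pos.2 hds).le
  linarith

theorem integral_add_mul_sq {r h : E d → ℝ} (hr : MemLp r 2 (volume.restrict Ω))
    (hh : MemLp h 2 (volume.restrict Ω)) (t : ℝ) :
    ∫ x in Ω, (r x + t * h x) ^ 2
      = (∫ x in Ω, r x ^ 2) + 2 * t * (∫ x in Ω, r x * h x) + t ^ 2 * ∫ x in Ω, h x ^ 2 := by
  have hi1 : Integrable (fun x => r x ^ 2) (volume.restrict Ω) := hr.integrable_sq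
  have hi2 : Integrable (fun x => 2 * t * (r x * h x)) (volume.restrict Ω) :=
    (hr.integrable_mul hh).const_mul _
  have hi3 : Integrable (fun x => t ^ 2 * h x ^ 2) (volume.restrict Ω) :=
    hh.integrable_sq.const_mul _
  have hi12 : Integrable (fun x => r x ^ 2 + 2 * t * (r x * h x)) (volume.restrict Ω) :=
    hi1.add hi2
  rw [← integral_const_mul, ← integral_const_mul, ← integral_add hi1 hi2, ← integral_add hi12 hi3]
  refine integral_congr_ae (Filter.Eventually.of_forall fun x => ?_)
  simp only
  ring

/-- The directional derivative of the cost functional at a minimizer is nonnegative. -/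
theorem variational_inequality [IsFiniteMeasure (volume.restrict Ω)] (hΩ : MeasurableSet Ω)
    {A : E d → Matrix (Fin d) (Fin d) ℝ} (hA : IsDiffusionMatrix Ω A)
    (hs : s ∈ Ioo (0 : ℝ) 1) {qbar c : ℝ} (hc : 0 < c)
    (hcoer : ∀ q ∈ admissible Ω qbar, ∀ w : Cyl Ω s, w ∈ HL Ω s → c * ‖w‖ ^ 2 ≤ form A q w w)
    {f : Hs Ω s →ₗ[ℝ] ℝ} (hf : IsHsDual Ω s f) {z : L2 Ω} {ρ : ℝ} {qstar : E d → ℝ}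
    (hqstar : MemLp qstar 2 (volume.restrict Ω)) {q₀ q : E d → ℝ}
    (hq₀ : q₀ ∈ admissible Ω qbar) (hq : q ∈ admissible Ω qbar)
    (hmin : ∀ q ∈ admissible Ω qbar, cost A f z ρ qstar q₀ ≤ cost A f z ρ qstar q) :
    0 ≤ -(1 / ds s) * mulForm (q - q₀) (state A f q₀) (adjointState A f z q₀)
      + ρ * ∫ x in Ω, (q₀ x - qstar x) * (q x - q₀ x) := by
  have hS : ∀ q ∈ admissible Ω qbar, IsState A f q (state A f q) := fun q hq =>
    isState_state (existsUnique_isState hΩ hA hs (admissible.memLp hq) hc (hcoer q hq) hf)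
  have hP := isAdjoint_adjointState
    (existsUnique_isAdjoint hΩ hA hs (admissible.memLp hq₀) hc (hcoer q₀ hq₀) f z)
  have hqm := admissible.memLp hq₀
  have hhm : MemLp (q - q₀) ∞ (volume.restrict Ω) := (admissible.memLp hq).sub hqm
  obtain ⟨K₁, hK₁, hb⟩ := exists_norm_state_le hΩ hs hc hcoer hf
  obtain ⟨K₂, hK₂, hlip⟩ :=
    exists_norm_state_sub_le hA hΩ hs.2 hqm hhm hc (hcoer q₀ hq₀) hK₁ (hS q₀ hq₀)
  obtain ⟨K₃, hinner⟩ := exists_inner_tr_sub_le hA hΩ hs hqm hhm (hS q₀ hq₀) hP (K' := K₂)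
  refine nonneg_of_forall_quadratic (K := K₃ + 1 / 2 * (traceConst s * K₂ ^ 2)
    + ρ / 2 * ∫ x in Ω, (q - q₀) x ^ 2) fun t ht => ?_
  have hqt := admissible.add_smul_mem hq₀ hq ht
  have hSt := hS _ hqt
  have hδ := hlip t _ ht.1.le hSt (hb _ hqt _ hSt)
  have hin := hinner t _ ht.1.le hSt hδ
  have hcost := hmin _ hqt
  have hδH := sub_mem_HL hΩ hs.2 hSt.1 (hS q₀ hq₀).1
  have htr := tr_sub hΩ hs hSt.1 (hS q₀ hq₀).1
  have htr_le : ‖tr (state A f (q₀ + t • (q - q₀)) - state A f q₀)‖ ^ 2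
      ≤ traceConst s * K₂ ^ 2 * t ^ 2 := by
    refine ((isTrace_tr hs hδH).norm_sq_le hs).trans ?_
    rw [mul_assoc, ← mul_pow]
    exact mul_le_mul_of_nonneg_left (pow_le_pow_left₀ (norm_nonneg _) hδ 2) (traceConst_pos hs.1).le
  have hnorm : ‖tr (state A f (q₀ + t • (q - q₀))) - z‖ ^ 2 = ‖tr (state A f q₀) - z‖ ^ 2
      + 2 * ⟪tr (state A f q₀) - z, tr (state A f (q₀ + t • (q - q₀)) - state A f q₀)⟫
      + ‖tr (state A f (q₀ + t • (q - q₀)) - state A f q₀)‖ ^ 2 := by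
    rw [← norm_add_sq_real, htr]
    congr 2
    abel
  have hreg := integral_add_mul_sq ((hqm.mono_exponent le_top).sub hqstar)
    (hhm.mono_exponent le_top) t
  have hreg' : ∫ x in Ω, ((q₀ + t • (q - q₀)) x - qstar x) ^ 2
      = ∫ x in Ω, ((q₀ - qstar) x + t * (q - q₀) x) ^ 2 :=
    integral_congr_ae (Filter.Eventually.of_forall fun x => by
      simp only [Pi.add_apply, Pi.smul_apply, Pi.sub_apply, smul_eq_mul]; ring)
  rw [cost, cost, hnorm, hreg', hreg] at hcost
  simp only [Pi.sub_apply] at hcost ⊢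
  linarith

end Optimality

/-! ### Convex polytopal domains and the conclusion -/

theorem IsConvexPolytopalDomain.isOpen {d : ℕ} {Ω : Set (E d)} (h : IsConvexPolytopalDomain Ω) :
    IsOpen Ω := by
  obtain ⟨-, S, rfl⟩ := h
  exact isOpen_interior

theorem IsConvexPolytopalDomain.isBounded {d : ℕ} {Ω : Set (E d)}
    (h : IsConvexPolytopalDomain Ω) : Bornology.IsBounded Ω := by
  obtain ⟨-, S, rfl⟩ := h
  exact (isBounded_convexHull.2 S.finite_toSet.isBounded).subset interior_subset

end FracIdent

theorem theorem3p6 (d : ℕ) (hd : d = 2 ∨ d = 3)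
    (Ω : Set (FracIdent.E d)) (hΩ : FracIdent.IsConvexPolytopalDomain Ω)
    (A : FracIdent.E d → Matrix (Fin d) (Fin d) ℝ) (hA : FracIdent.IsDiffusionMatrix Ω A)
    (qbar : ℝ) (hqbar : 0 < qbar)
    (s : ℝ) (hs : s ∈ Set.Ioo (0 : ℝ) 1)
    (f : FracIdent.Hs Ω s →ₗ[ℝ] ℝ) (hf : FracIdent.IsHsDual Ω s f)
    (z : FracIdent.L2 Ω) (ρ : ℝ) (hρ : 0 < ρ)
    (qstar : FracIdent.E d → ℝ) (hqstar : MemLp qstar 2 (volume.restrict Ω)) :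
    -- the state and adjoint problems are uniquely solvable
    (∀ q ∈ FracIdent.admissible Ω qbar,
      (∃! u, FracIdent.IsState A f q u) ∧ ∃! P, FracIdent.IsAdjoint A f z q P) ∧
    ∀ q₀ ∈ FracIdent.admissible Ω qbar,
      -- the minimization hypothesis
      (∀ q ∈ FracIdent.admissible Ω qbar,
        FracIdent.cost A f z ρ qstar q₀ ≤ FracIdent.cost A f z ρ qstar q) →
      MemLp (FracIdent.eFun A f q₀) ∞ (volume.restrict Ω) →
      -- the optimality condition
      MemLp (FracIdent.pFun A f z q₀) 2 (volume.restrict Ω) ∧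
      ∀ q ∈ FracIdent.admissible Ω qbar,
        0 ≤ ∫ x in Ω, (FracIdent.pFun A f z q₀ x + ρ * (q₀ x - qstar x)) * (q x - q₀ x) := by
  have hΩm : MeasurableSet Ω := hΩ.isOpen.measurableSet
  have hfin : IsFiniteMeasure (volume.restrict Ω) :=
    isFiniteMeasure_restrict.2 hΩ.isBounded.measure_lt_top.ne
  obtain ⟨R, hR⟩ := hΩ.isBounded.exists_norm_le
  have hd0 : 0 < d := by omega
  have hu : ‖EuclideanSpace.single (⟨0, hd0⟩ : Fin d) (1 : ℝ)‖ = 1 := by simp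
  obtain ⟨c, hc, hcoer⟩ := FracIdent.exists_coercive hA hs.2 hR hu qbar
  refine ⟨fun q hq => ⟨FracIdent.existsUnique_isState hΩm hA hs (FracIdent.admissible.memLp hq) hc
      (hcoer q hq) hf,
    FracIdent.existsUnique_isAdjoint hΩm hA hs (FracIdent.admissible.memLp hq) hc (hcoer q hq) f z⟩,
    fun q₀ hq₀ hmin he => ?_⟩
  have hp : MemLp (FracIdent.pFun A f z q₀) 2 (volume.restrict Ω) := FracIdent.memLp_pFun he
  refine ⟨hp, fun q hq => ?_⟩
  have hq₀m := FracIdent.admissible.memLp hq₀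
  have hhm : MemLp (q - q₀) ∞ (volume.restrict Ω) := (FracIdent.admissible.memLp hq).sub hq₀m
  have hh2 : MemLp (fun x => q x - q₀ x) 2 (volume.restrict Ω) := hhm.mono_exponent le_top
  have hr2 : MemLp (fun x => q₀ x - qstar x) 2 (volume.restrict Ω) :=
    (hq₀m.mono_exponent le_top).sub hqstar
  have hi1 : Integrable (fun x => FracIdent.pFun A f z q₀ x * (q x - q₀ x))
      (volume.restrict Ω) := hp.integrable_mul hh2
  have hi2 : Integrable (fun x => ρ * ((q₀ x - qstar x) * (q x - q₀ x))) (volume.restrict Ω) :=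
    (hr2.integrable_mul hh2).const_mul ρ
  have hvar := FracIdent.variational_inequality hΩm hA hs hc hcoer hf hqstar hq₀ hq hmin
  rw [← FracIdent.integral_pFun_mul hhm, ← integral_const_mul] at hvar
  simp only [Pi.sub_apply] at hvar
  rw [← integral_add hi1 hi2] at hvar
  refine hvar.trans_eq (integral_congr_ae (Filter.Eventually.of_forall fun x => ?_))
  simp only
  ring
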